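/- \textbf{Setting.} Signals are real functions considered on $[0,\infty)$ up to null sets. $\mathcal{L}_2$ has the norm $\|y\|=(\int_0^\infty y^2\,dt)^{1/2}$, $\mathcal{L}_{2e}$ is the space of signals with finite energy on every $[0,\tau]$, and $\mathcal{P}\subset\mathcal{L}_{2e}$ is the space on which the seminorm $\|y\|_P=(\limsup_{\tau\to\infty}\frac1\tau\int_0^\tau y^2\,dt)^{1/2}$ is finite. A signal has period $T$ if $y(t+T)=y(t)$ for $t\ge 0$. Let $\boldsymbol G$ be a causal convolution operator with impulse response $g(t)=\sum_{i\ge 0} g_i\delta(t-t_i)+g_a(t)$ for $t\ge 0$, where $0\le t_0<t_1<\cdots$ and $\sum_i|g_i|+\int_0^\infty|g_a|\,dt<\infty$, and let $G(j\omega)$ be its frequency response. Let $Q:\mathbb{R}\to\mathbb{R}$ be monotone (nondecreasing) with $|Q(x)|\le C|x|$ for some $C$ and all $x$. The Lurye system is $$y_1=\boldsymbol G u_1,\quad y_2=Q(u_2),\quad u_1=r_1-y_2,\quad u_2=y_1+r_2\qquad\text{on }[0,\infty).$$ An initial condition of the system is a past of the input $u_1$ of $\boldsymbol G$ on $(-\infty,0)$,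 with $\sup_{a\le 0}\int_{a-1}^a u_1^2\,dt<\infty$, and $\boldsymbol G u_1$ is the convolution of $g$ with the whole of $u_1$. A solution consists of signals $u_1,u_2,y_1,y_2\in\mathcal{L}_{2e}$ and an initial condition. The system is assumed to be well-posed: with zero initial condition, for all $r_1,r_2\in\mathcal{L}_{2e}$ there is a solution, and it is unique and depends causally on $(r_1,r_2)$. For $T>0$ let $\mathcal{A}_T$ be the set of (Altshuller) multipliers with impulse response $\delta(t)-\sum_{n\in\mathbb{Z}}h_n\delta(t-nT)$, where $h_0=0$, $h_n\ge 0$ and $\sum_n h_n<1$; the frequency response is $M(j\omega)=1-\sum_n h_n e^{-j\omega nT}$. $\boldsymbol M$ is suitable for a frequency function $F$ if for some $\varepsilon>0$ we have $\operatorname{Re}\{M(j\omega)F(j\omega)\}>\varepsilon$ for all $\omega\in\mathbb{R}$. \textbf{Theorem 7.} Let $T>0$ and let $r_2^*\in\mathcal{L}_{2e}$ be non-zero with period $T$. Suppose that for $r_1=0$ and $r_2=r_2^*$ there is, for some initial condition, a solution $(u_1^*,u_2^*,y_1^*,y_2^*)$ all of whose signals have period $T$, with $y_2^*\ne 0$.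 Suppose either (i) there is an $\boldsymbol M\in\mathcal{A}_T$ suitable for $F=G$; or (ii) for some $k>0$, $0\le (Q(x_1)-Q(x_2))/(x_1-x_2)\le k$ for all $x_1\ne x_2$, and there is an $\boldsymbol M\in\mathcal{A}_T$ suitable for $F=1/k+G$. Then, with $r_1=0$ throughout: 1. The periodic solution is unique: over all initial conditions, it is the only solution for $r_2=r_2^*$ with period $T$, and $y_2^*$ is the only output $y_2$ with period $T$. 2. The periodic solution is a global attractor: for every solution with $r_2-r_2^*\in\mathcal{L}_2$ (in particular with $r_2=r_2^*$) such that the response of $\boldsymbol G$ on $[0,\infty)$ to the difference of the past inputs of the two solutions is in $\mathcal{L}_2$, the deviations $u_i-u_i^*$ and $y_i-y_i^*$, $i=1,2$, are in $\mathcal{L}_2$, so that their energy on $[\tau,\infty)$ tends to zero as $\tau\to\infty$. For every solution with $r_2=r_2^*$, from any initial condition, these deviations have zero power seminorm. 3. Let $$h=\sup_{\omega\in\mathbb{R}}\frac{1+|M(j\omega)|^2}{2\operatorname{Re}\{M(j\omega)F(j\omega)\}}.$$ Then $h<\infty$. If $r_2-r_2^*\in\mathcal{L}_2$ and the solution has the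 same initial condition as the periodic solution, then $\|y_2-y_2^*\|\le h\,\|r_2-r_2^*\|$. If $r_2-r_2^*\in\mathcal{P}$, then for every initial condition $\|y_2-y_2^*\|_P\le h\,\|r_2-r_2^*\|_P$. -/

import Mathlib

open MeasureTheory Filter Topology Set
open scoped ENNReal NNReal

noncomputable section

/-! ## Signals

A signal is a function `ℝ → ℝ`. The time line of the feedback system is `[0, ∞)`; values at negative
times are used only for the input of the linear element, where they encode its initial condition. -/

/-- Finite energy signals on `[0, ∞)`. -/
def MemL2 (y : ℝ → ℝ) : Prop := MemLp y 2 (volume.restrict (Ici 0))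

/-- The extended space: finite energy on every interval `[0, τ]`. -/
def MemL2e (y : ℝ → ℝ) : Prop := ∀ τ : ℝ, MemLp y 2 (volume.restrict (Icc 0 τ))

/-- The norm of `𝓛₂[0, ∞)` (infinite if the energy is infinite). -/
def normL2 (y : ℝ → ℝ) : ℝ≥0∞ := eLpNorm y 2 (volume.restrict (Ici 0))

/-- The power seminorm `(limsup_{τ → ∞} (1 / τ) ∫₀^τ y²)^(1/2)`. -/
def powerSeminorm (y : ℝ → ℝ) : ℝ≥0∞ :=
  (limsup (fun τ : ℝ => (∫⁻ t in Icc 0 τ, ‖y t‖ₑ ^ 2) / ENNReal.ofReal τ) atTop) ^ (1 / 2 : ℝ)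

/-- Power signals. -/
def MemPower (y : ℝ → ℝ) : Prop := MemL2e y ∧ powerSeminorm y < ∞

/-- Equality of signals on `[0, ∞)` (almost everywhere). -/
def EqSignal (x y : ℝ → ℝ) : Prop := ∀ᵐ t ∂(volume.restrict (Ici (0 : ℝ))), x t = y t

/-- Periodicity with period `T` on `[0, ∞)`. -/
def PeriodicSignal (T : ℝ) (y : ℝ → ℝ) : Prop := EqSignal (fun t => y (t + T)) y

/-- The energy of `y` beyond time `τ` tends to zero as `τ → ∞`. -/
def EnergyVanishes (y : ℝ → ℝ) : Prop :=
  Tendsto (fun τ : ℝ => eLpNorm y 2 (volume.restrict (Ici τ))) atTop (𝓝 0)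

/-! ## The linear element -/

/-- Stable causal convolution operators, with impulse response `∑ gᵢ δ(t - tᵢ) + gₐ(t)` for `t ≥ 0`,
where `0 ≤ t₀ < t₁ < ⋯` and `∑ |gᵢ| + ∫₀^∞ |gₐ| < ∞`. -/
structure StableLTI where
  coeff : ℕ → ℝ
  delay : ℕ → ℝ
  kernel : ℝ → ℝ
  delay_nonneg : 0 ≤ delay 0
  delay_strictMono : StrictMono delay
  summable_coeff : Summable fun i => |coeff i|
  integrable_kernel : IntegrableOn kernel (Ici 0)

namespace StableLTI

/-- The convolution of the impulse response with `u : ℝ → ℝ`. The operator on the extended space is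
the case where `u` vanishes at negative times. -/
def apply (G : StableLTI) (u : ℝ → ℝ) (t : ℝ) : ℝ :=
  (∑' i, G.coeff i * u (t - G.delay i)) + ∫ s in Ici (0 : ℝ), G.kernel s * u (t - s)

/-- The free response: the contribution to the output at times `t ≥ 0` of the values of the input at
negative times. -/
def freeResponse (G : StableLTI) (u : ℝ → ℝ) : ℝ → ℝ := G.apply ((Iio (0 : ℝ)).indicator u)

/-- The frequency response `G(jω)`. -/
def freq (G : StableLTI) (ω : ℝ) : ℂ :=
  (∑' i, (G.coeff i : ℂ) * Complex.exp (-(Complex.I * ω * G.delay i))) +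
    ∫ s in Ici (0 : ℝ), (G.kernel s : ℂ) * Complex.exp (-(Complex.I * ω * s))

end StableLTI

/-- Admissible past inputs: uniformly locally square integrable on `(-∞, 0)`. This contains the zero
past, all periodic pasts (locally square integrable), bounded pasts and pasts of finite energy. -/
def AdmissiblePast (u : ℝ → ℝ) : Prop :=
  AEStronglyMeasurable u (volume.restrict (Iio 0)) ∧
    ∃ C : ℝ≥0, ∀ a : ℝ, a ≤ 0 → eLpNorm u 2 (volume.restrict (Icc (a - 1) a)) ≤ C

/-! ## The nonlinear element -/

/-- `Q` characterises a time-invariant memoryless, monotone and bounded operator `u ↦ Q ∘ u`. -/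
def IsMMB (Q : ℝ → ℝ) : Prop := Monotone Q ∧ ∃ C : ℝ, 0 ≤ C ∧ ∀ x, |Q x| ≤ C * |x|

/-- `Q` is slope-restricted on `[0, k]`. -/
def SlopeRestricted (k : ℝ) (Q : ℝ → ℝ) : Prop :=
  ∀ x₁ x₂ : ℝ, x₁ ≠ x₂ → 0 ≤ (Q x₁ - Q x₂) / (x₁ - x₂) ∧ (Q x₁ - Q x₂) / (x₁ - x₂) ≤ k

/-! ## The Lurye system -/

/-- The four internal signals of the loop. -/
structure LoopSignals where
  u₁ : ℝ → ℝ
  u₂ : ℝ → ℝ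
  y₁ : ℝ → ℝ
  y₂ : ℝ → ℝ

/-- `x` solves the Lurye equations `y₁ = G u₁`, `y₂ = Q(u₂)`, `u₁ = r₁ - y₂`, `u₂ = y₁ + r₂` on
`[0, ∞)`. The initial condition is the past of `u₁`, which is not constrained by the loop. -/
structure IsLuryeSolution (G : StableLTI) (Q : ℝ → ℝ) (r₁ r₂ : ℝ → ℝ) (x : LoopSignals) : Prop where
  u₁_mem : MemL2e x.u₁
  u₂_mem : MemL2e x.u₂
  y₁_mem : MemL2e x.y₁
  y₂_mem : MemL2e x.y₂
  past : AdmissiblePast x.u₁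
  eq_y₁ : EqSignal x.y₁ (G.apply x.u₁)
  eq_y₂ : EqSignal x.y₂ (fun t => Q (x.u₂ t))
  eq_u₁ : EqSignal x.u₁ (fun t => r₁ t - x.y₂ t)
  eq_u₂ : EqSignal x.u₂ (fun t => x.y₁ t + r₂ t)

/-- Two input histories are the same (almost everywhere on `(-∞, 0)`). -/
def SamePast (u v : ℝ → ℝ) : Prop := ∀ᵐ t ∂(volume.restrict (Iio (0 : ℝ))), u t = v t

/-- Well-posedness, with zero initial conditions: for all exogenous signals in the extended space
there is a solution in the extended space, and it is unique and depends causally on them. -/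
def WellPosed (G : StableLTI) (Q : ℝ → ℝ) : Prop :=
  (∀ r₁ r₂, MemL2e r₁ → MemL2e r₂ → ∃ x, IsLuryeSolution G Q r₁ r₂ x ∧ SamePast x.u₁ 0) ∧
  (∀ r₁ r₂ r₁' r₂' x x', MemL2e r₁ → MemL2e r₂ → MemL2e r₁' → MemL2e r₂' →
    IsLuryeSolution G Q r₁ r₂ x → SamePast x.u₁ 0 →
    IsLuryeSolution G Q r₁' r₂' x' → SamePast x'.u₁ 0 →
    ∀ τ : ℝ, (∀ᵐ t ∂(volume.restrict (Icc 0 τ)), r₁ t = r₁' t ∧ r₂ t = r₂' t) →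
      ∀ᵐ t ∂(volume.restrict (Icc 0 τ)),
        x.u₁ t = x'.u₁ t ∧ x.u₂ t = x'.u₂ t ∧ x.y₁ t = x'.y₁ t ∧ x.y₂ t = x'.y₂ t)

/-- `x` is a solution, for some initial condition, with `r₁ = 0`, and it has period `T`. -/
structure IsPeriodicSolution (G : StableLTI) (Q : ℝ → ℝ) (T : ℝ) (r₂ : ℝ → ℝ) (x : LoopSignals) :
    Prop where
  sol : IsLuryeSolution G Q 0 r₂ x
  u₁_per : PeriodicSignal T x.u₁
  u₂_per : PeriodicSignal T x.u₂
  y₁_per : PeriodicSignal T x.y₁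
  y₂_per : PeriodicSignal T x.y₂

/-- `p` is the only solution with period `T` for `r₁ = 0` and the given `r₂`, over all initial
conditions; moreover no other `T`-periodic signal occurs as an output `y₂`. -/
def IsUniquePeriodicSolution (G : StableLTI) (Q : ℝ → ℝ) (T : ℝ) (r₂ : ℝ → ℝ) (p : LoopSignals) :
    Prop :=
  (∀ x, IsPeriodicSolution G Q T r₂ x →
    EqSignal x.u₁ p.u₁ ∧ EqSignal x.u₂ p.u₂ ∧ EqSignal x.y₁ p.y₁ ∧ EqSignal x.y₂ p.y₂) ∧
  (∀ x, IsLuryeSolution G Q 0 r₂ x → PeriodicSignal T x.y₂ → EqSignal x.y₂ p.y₂)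

/-- `p` is a global attractor for `r₁ = 0`, `r₂ = r₂*`.
* If the free response caused by the deviation of the initial condition has finite energy (of any
  size), then all deviations from `p` have finite energy and so die out; this persists if `r₂`
  deviates from `r₂*` by a signal of finite energy, that is, the deviation system is `𝓛₂`-stable.
* From every initial condition, the deviations from `p` have zero power. -/
def IsGlobalAttractor (G : StableLTI) (Q : ℝ → ℝ) (r₂s : ℝ → ℝ) (p : LoopSignals) : Prop :=
  (∀ r₂ x, MemL2 (r₂ - r₂s) → IsLuryeSolution G Q 0 r₂ x →
    MemL2 (G.freeResponse (x.u₁ - p.u₁)) →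
      (MemL2 (x.u₁ - p.u₁) ∧ EnergyVanishes (x.u₁ - p.u₁)) ∧
      (MemL2 (x.u₂ - p.u₂) ∧ EnergyVanishes (x.u₂ - p.u₂)) ∧
      (MemL2 (x.y₁ - p.y₁) ∧ EnergyVanishes (x.y₁ - p.y₁)) ∧
      (MemL2 (x.y₂ - p.y₂) ∧ EnergyVanishes (x.y₂ - p.y₂))) ∧
  (∀ x, IsLuryeSolution G Q 0 r₂s x →
    powerSeminorm (x.u₁ - p.u₁) = 0 ∧ powerSeminorm (x.u₂ - p.u₂) = 0 ∧
    powerSeminorm (x.y₁ - p.y₁) = 0 ∧ powerSeminorm (x.y₂ - p.y₂) = 0)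

/-- The bounds on the deviation of the output `y₂` from that of `p`, with constant `h`: in `𝓛₂` for
solutions with the initial condition of `p` (deviations start from zero), and in power for solutions
from every initial condition. -/
def DeviationBounds (G : StableLTI) (Q : ℝ → ℝ) (r₂s : ℝ → ℝ) (p : LoopSignals) (h : ℝ≥0∞) : Prop :=
  (∀ r₂ x, IsLuryeSolution G Q 0 r₂ x → SamePast x.u₁ p.u₁ → MemL2 (r₂ - r₂s) →
    normL2 (x.y₂ - p.y₂) ≤ h * normL2 (r₂ - r₂s)) ∧
  (∀ r₂ x, IsLuryeSolution G Q 0 r₂ x → MemPower (r₂ - r₂s) →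
    powerSeminorm (x.y₂ - p.y₂) ≤ h * powerSeminorm (r₂ - r₂s))

/-! ## Multipliers -/

/-- Altshuller multipliers with period `T`: convolution operators with (possibly non-causal) impulse
response `δ(t) - ∑ₙ hₙ δ(t - nT)`, where `h₀ = 0`, `hₙ ≥ 0` and `∑ₙ hₙ < 1`. -/
structure AltshullerMultiplier (T : ℝ) where
  h : ℤ → ℝ
  h_zero : h 0 = 0
  h_nonneg : ∀ n, 0 ≤ h n
  summable_h : Summable h
  sum_lt_one : ∑' n, h n < 1

/-- The frequency response `M(jω)`. -/
def AltshullerMultiplier.freq {T : ℝ} (M : AltshullerMultiplier T) (ω : ℝ) : ℂ :=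
  1 - ∑' n : ℤ, (M.h n : ℂ) * Complex.exp (-(Complex.I * ω * (n * T)))

/-- The frequency function `M` is suitable for `F`. -/
def Suitable (M F : ℝ → ℂ) : Prop := ∃ ε : ℝ, 0 < ε ∧ ∀ ω, ε < (M ω * F ω).re

/-- `sup_ω (1 + |M|²) / (2 Re[M F])`: the bound on the gain from `r₂` to `y₂`, where `F` is `G` for a
monotone nonlinearity and `1/k + G` for a nonlinearity that is slope-restricted on `[0, k]`. -/
def gainBound (M F : ℝ → ℂ) : ℝ≥0∞ :=
  ⨆ ω, ENNReal.ofReal ((1 + ‖M ω‖ ^ 2) / (2 * (M ω * F ω).re))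

end

/-! Compare a solution with the periodic one. Let `d`, `e` be the deviations of `y₂`, `u₂`, and let
`ρ` be the deviation of `r₂` plus the free response due to the different pasts. On `[0, τ]` the loop
reads `d = Q(u + e) - Q(u)` and `e = ρ - G d`, where `u` is the periodic extension of the signal
`u₂` of the periodic solution. Everything follows from the truncated bound `‖d‖ ≤ h ‖ρ‖` on `[0,
τ]`, uniform in `τ` (`eLpNorm_deviation_y₂_le`).

Two positivity facts oppose each other around the loop. In the time domain, `e ↦ Q(u + e) - Q(u)` is
monotone and varies periodically in time, so its output correlates at least as well with `e` as with
any translate of `e` by a multiple of `T` (`inner_translateL2_le_inner`). Since the nonnegative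
weights sum to less than one, the output pairs nonnegatively with `M e`. In the frequency domain,
the autocorrelation of an `L²` signal `f` is the Fourier transform of a finite measure, so the
pointwise inequality defining `h` integrates to `‖f‖² + ‖M* f‖² ≤ 2h ⟨M* f, (κ + G) f⟩`
(`quadratic_form_bound`).

The multiplier is not causal, so it does not commute with truncation. The delay part of `M` has norm
below one, so a Neumann series continues the truncated output `D` by some `z` after `τ` with `M*(D +
z) = 0` there. With `f = D + z`, the pairing of `M* f` with `G f` then sees only times up to `τ`,
where causality and the loop equation apply. Dually, the truncated error is continued by some `w`
such that `M` annihilates the sum after `τ`. This reduces the sign of the nonlinear term to the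
time-domain positivity. Because `Q` is only linearly bounded around a signal of infinite energy,
that positivity is applied on finite sections `(τ, τ + n]`, followed by a limit. Completing a square
gives the gain bound (`norm_le_of_positivity`).

For a slope restriction, `κ = 1/k` is moved from the nonlinear to the linear element: for `l < 1`,
`Q` is a monotone function of `x - lκ Q x`, and `l → 1` (`norm_output_le`). The monotone case is `κ
= 0`.

Finally, the free response to an admissible past has zero power (`StableLTI.zeroPower_apply`). So
all deviations have zero power when `r₂` is unchanged, and a periodic signal with zero power
vanishes, which gives uniqueness. -/

noncomputable section

/-! ## Convolution with a signed measure given by weights and delays -/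

section DelayConvolution

variable {X : Type*} [MeasurableSpace X] {μ : Measure X} [SFinite μ] {c : X → ℝ} {δ : X → ℝ}

/-- The superposition of the translates of `u` by the delays `δ x`, with weights `c x`. -/
def delayConv (μ : Measure X) (c δ : X → ℝ) (u : ℝ → ℝ) (t : ℝ) : ℝ :=
  ∫ x, c x * u (t - δ x) ∂μ

/-- For each fixed delay the map is a translation, so null sets pull back to null sets of the
product. Convolution is therefore well defined on almost-everywhere classes. -/
theorem quasiMeasurePreserving_sub_delay (hδ : Measurable δ) :
    Measure.QuasiMeasurePreserving (fun p : ℝ × X => p.1 - δ p.2) (volume.prod μ) volume := by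
  refine QuasiMeasurePreserving.prod_of_left (by fun_prop) (Eventually.of_forall fun x => ?_)
  exact (measurePreserving_sub_right volume (δ x)).quasiMeasurePreserving

theorem aestronglyMeasurable_comp_sub_delay (hδ : Measurable δ) {E : Type*} [TopologicalSpace E]
    {u : ℝ → E} (hu : AEStronglyMeasurable u volume) :
    AEStronglyMeasurable (fun p : ℝ × X => u (p.1 - δ p.2)) (volume.prod μ) :=
  hu.comp_quasiMeasurePreserving (quasiMeasurePreserving_sub_delay hδ)

theorem aestronglyMeasurable_weighted (hc : AEStronglyMeasurable c μ) (hδ : Measurable δ)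
    {u : ℝ → ℝ} (hu : AEStronglyMeasurable u volume) :
    AEStronglyMeasurable (fun p : ℝ × X => c p.2 * u (p.1 - δ p.2)) (volume.prod μ) :=
  hc.comp_snd.mul (aestronglyMeasurable_comp_sub_delay hδ hu)

theorem aestronglyMeasurable_delayConv (hc : AEStronglyMeasurable c μ) (hδ : Measurable δ)
    {u : ℝ → ℝ} (hu : AEStronglyMeasurable u volume) :
    AEStronglyMeasurable (delayConv μ c δ u) volume :=
  (aestronglyMeasurable_weighted hc hδ hu).integral_prod_right'

theorem delayConv_congr_ae (hδ : Measurable δ) {u v : ℝ → ℝ} (h : u =ᵐ[volume] v) :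
    delayConv μ c δ u =ᵐ[volume] delayConv μ c δ v := by
  have h1 : ∀ᵐ p ∂((volume : Measure ℝ).prod μ), u (p.1 - δ p.2) = v (p.1 - δ p.2) :=
    (quasiMeasurePreserving_sub_delay hδ).ae h
  filter_upwards [Measure.ae_ae_of_ae_prod h1] with t ht
  exact integral_congr_ae (ht.mono fun x hx => by simp only [hx])

omit [SFinite μ] in
-- Cauchy–Schwarz for the splitting `a b = a^(1/2) · (a^(1/2) b)`.
theorem sq_lintegral_mul_le {a b : X → ℝ≥0∞} (ha : AEMeasurable a μ) (hb : AEMeasurable b μ) :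
    (∫⁻ x, a x * b x ∂μ) ^ 2 ≤ (∫⁻ x, a x ∂μ) * ∫⁻ x, a x * b x ^ 2 ∂μ := by
  have hs : ∀ y : ℝ≥0∞, (y ^ (1 / 2 : ℝ)) * y ^ (1 / 2 : ℝ) = y := fun y => by
    rw [← ENNReal.rpow_add_of_nonneg _ _ (by norm_num) (by norm_num)]; norm_num
  have hs2 : ∀ y : ℝ≥0∞, (y ^ (1 / 2 : ℝ)) ^ 2 = y := fun y => by rw [sq, hs]
  have h := ENNReal.lintegral_mul_le_Lp_mul_Lq μ Real.HolderConjugate.two_two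
    (f := fun x => a x ^ (1 / 2 : ℝ)) (g := fun x => a x ^ (1 / 2 : ℝ) * b x)
    (ha.pow_const _) ((ha.pow_const _).mul hb)
  have e1 : ∫⁻ x, ((fun x => a x ^ (1 / 2 : ℝ)) * fun x => a x ^ (1 / 2 : ℝ) * b x) x ∂μ
      = ∫⁻ x, a x * b x ∂μ := by
    refine lintegral_congr fun x => ?_
    simp only [Pi.mul_apply, ← mul_assoc, hs]
  have e2 : ∫⁻ x, (a x ^ (1 / 2 : ℝ)) ^ (2 : ℝ) ∂μ = ∫⁻ x, a x ∂μ := by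
    refine lintegral_congr fun x => ?_
    rw [ENNReal.rpow_two, hs2]
  have e3 : ∫⁻ x, (a x ^ (1 / 2 : ℝ) * b x) ^ (2 : ℝ) ∂μ = ∫⁻ x, a x * b x ^ 2 ∂μ := by
    refine lintegral_congr fun x => ?_
    rw [ENNReal.rpow_two, mul_pow, hs2]
  rw [e1, e2, e3] at h
  calc _ ≤ _ := pow_le_pow_left' h 2
    _ = _ := by rw [mul_pow, hs2, hs2]

/-- Convolution with the absolute values of the weights and of the signal. -/
def absDelayConv (μ : Measure X) (c δ : X → ℝ) (u : ℝ → ℝ) (t : ℝ) : ℝ≥0∞ :=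
  ∫⁻ x, ‖c x‖ₑ * ‖u (t - δ x)‖ₑ ∂μ

omit [SFinite μ] in
theorem enorm_delayConv_le (u : ℝ → ℝ) (t : ℝ) :
    ‖delayConv μ c δ u t‖ₑ ≤ absDelayConv μ c δ u t := by
  refine (enorm_integral_le_lintegral_enorm _).trans_eq ?_
  simp only [absDelayConv, enorm_mul]

/-- Weighted Cauchy–Schwarz at each time, then Tonelli. Keeping `A` arbitrary lets one estimate give
the `L²` gain, almost everywhere convergence, and the decay of the power of the free response. -/
theorem setLIntegral_sq_absDelayConv_le (hc : AEStronglyMeasurable c μ) (hδ : Measurable δ)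
    {u : ℝ → ℝ} (hu : AEStronglyMeasurable u volume) (A : Set ℝ) :
    ∫⁻ t in A, absDelayConv μ c δ u t ^ 2 ≤
      (∫⁻ x, ‖c x‖ₑ ∂μ) * ∫⁻ x, ‖c x‖ₑ * (∫⁻ t in A, ‖u (t - δ x)‖ₑ ^ 2) ∂μ := by
  have hm : AEMeasurable (fun p : ℝ × X => ‖u (p.1 - δ p.2)‖ₑ) (volume.prod μ) :=
    (aestronglyMeasurable_comp_sub_delay hδ hu).enorm
  have hle : (volume.restrict A).prod μ ≤ (volume : Measure ℝ).prod μ := by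
    have := Measure.prod_restrict (μ := (volume : Measure ℝ)) (ν := μ) A univ
    rw [Measure.restrict_univ] at this
    rw [this]; exact Measure.restrict_le_self
  have hsec : ∀ᵐ t ∂(volume : Measure ℝ), AEMeasurable (fun x => ‖u (t - δ x)‖ₑ) μ :=
    (aestronglyMeasurable_comp_sub_delay hδ hu).prodMk_left.mono fun t ht => ht.enorm
  calc ∫⁻ t in A, absDelayConv μ c δ u t ^ 2
      ≤ ∫⁻ t in A, (∫⁻ x, ‖c x‖ₑ ∂μ) * ∫⁻ x, ‖c x‖ₑ * ‖u (t - δ x)‖ₑ ^ 2 ∂μ := by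
        refine lintegral_mono_ae ((ae_restrict_of_ae hsec).mono fun t ht => ?_)
        exact sq_lintegral_mul_le hc.enorm ht
    _ = (∫⁻ x, ‖c x‖ₑ ∂μ) * ∫⁻ t in A, ∫⁻ x, ‖c x‖ₑ * ‖u (t - δ x)‖ₑ ^ 2 ∂μ := by
        refine lintegral_const_mul'' _ ?_
        exact ((hc.enorm.comp_snd.mul (hm.pow_const 2)).mono_measure hle).lintegral_prod_right'
    _ = (∫⁻ x, ‖c x‖ₑ ∂μ) * ∫⁻ x, (∫⁻ t in A, ‖c x‖ₑ * ‖u (t - δ x)‖ₑ ^ 2) ∂μ := by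
        rw [lintegral_lintegral_swap]
        exact (hc.enorm.comp_snd.mul (hm.pow_const 2)).mono_measure hle
    _ = _ := by
        congr 1
        refine lintegral_congr fun x => ?_
        rw [lintegral_const_mul' _ _ enorm_ne_top]

/-! ### Convergence of the convolution on uniformly locally square integrable inputs -/

/-- Uniformly locally square integrable signals on `ℝ`. -/
def UnifLocL2 (u : ℝ → ℝ) : Prop :=
  AEStronglyMeasurable u volume ∧
    ∃ C : ℝ≥0∞, C < ∞ ∧ ∀ a : ℝ, ∫⁻ t in Icc a (a + 1), ‖u t‖ₑ ^ 2 ≤ C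

theorem lintegral_enorm_sq_eq {α : Type*} [MeasurableSpace α] (ν : Measure α) (u : α → ℝ) :
    ∫⁻ t, ‖u t‖ₑ ^ 2 ∂ν = eLpNorm u 2 ν ^ 2 := by
  rw [eLpNorm_eq_lintegral_rpow_enorm_toReal (by norm_num) (by norm_num), ← ENNReal.rpow_natCast,
    ← ENNReal.rpow_mul]
  norm_num

theorem lintegral_enorm_sq_lt_top {α : Type*} [MeasurableSpace α] {ν : Measure α} {u : α → ℝ}
    (hu : MemLp u 2 ν) : ∫⁻ t, ‖u t‖ₑ ^ 2 ∂ν < ∞ := by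
  rw [lintegral_enorm_sq_eq]; exact ENNReal.pow_lt_top hu.2

theorem MeasureTheory.MemLp.unifLocL2 {u : ℝ → ℝ} (hu : MemLp u 2 volume) : UnifLocL2 u :=
  ⟨hu.1, _, lintegral_enorm_sq_lt_top hu, fun _ => setLIntegral_le_lintegral _ _⟩

theorem UnifLocL2.translate_le {u : ℝ → ℝ} {C : ℝ≥0∞}
    (h : ∀ a : ℝ, ∫⁻ t in Icc a (a + 1), ‖u t‖ₑ ^ 2 ≤ C) (a s : ℝ) :
    ∫⁻ t in Icc a (a + 1), ‖u (t - s)‖ₑ ^ 2 ≤ C := by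
  refine le_trans (le_of_eq ?_) (h (a - s))
  rw [← lintegral_indicator measurableSet_Icc, ← lintegral_indicator measurableSet_Icc,
    ← lintegral_sub_right_eq_self ((Icc (a - s) (a - s + 1)).indicator fun t => ‖u t‖ₑ ^ 2) s]
  refine lintegral_congr fun t => ?_
  simp only [indicator, mem_Icc]
  congr 1
  simp only [eq_iff_iff]
  constructor <;> rintro ⟨h1, h2⟩ <;> constructor <;> linarith

theorem ae_of_forall_ae_Icc {P : ℝ → Prop}
    (h : ∀ n : ℤ, ∀ᵐ t ∂(volume.restrict (Icc (n : ℝ) (n + 1))), P t) : ∀ᵐ t : ℝ, P t := by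
  have h2 : ∀ᵐ t : ℝ, ∀ n : ℤ, t ∈ Icc (n : ℝ) (n + 1) → P t :=
    ae_all_iff.2 fun n => (ae_restrict_iff' measurableSet_Icc).1 (h n)
  filter_upwards [h2] with t ht
  exact ht ⌊t⌋ ⟨Int.floor_le t, (Int.lt_floor_add_one t).le⟩

/-- The bound on unit intervals is invariant under every delay, so the squared convolution is
integrable on each unit interval. This rules out default values of divergent sums and integrals at
almost every time. -/
theorem UnifLocL2.absDelayConv_lt_top (hc : Integrable c μ) (hδ : Measurable δ) {u : ℝ → ℝ}
    (hu : UnifLocL2 u) : ∀ᵐ t : ℝ, absDelayConv μ c δ u t < ∞ := by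
  obtain ⟨hum, C, hC, hb⟩ := hu
  refine ae_of_forall_ae_Icc fun n => ?_
  have h := setLIntegral_sq_absDelayConv_le hc.1 hδ hum (Icc (n : ℝ) (n + 1))
  have hfin : ∫⁻ t in Icc (n : ℝ) (n + 1), absDelayConv μ c δ u t ^ 2 < ∞ := by
    refine h.trans_lt (ENNReal.mul_lt_top hc.2 ?_)
    calc _ ≤ ∫⁻ x, ‖c x‖ₑ * C ∂μ := by
          exact lintegral_mono fun x => mul_le_mul_right (UnifLocL2.translate_le hb _ _) _
      _ = (∫⁻ x, ‖c x‖ₑ ∂μ) * C := lintegral_mul_const' _ _ hC.ne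
      _ < ∞ := ENNReal.mul_lt_top hc.2 hC
  have hm : AEMeasurable (fun t => absDelayConv μ c δ u t) volume := by
    refine AEMeasurable.lintegral_prod_right' (f := fun p : ℝ × X => ‖c p.2‖ₑ * ‖u (p.1 - δ p.2)‖ₑ) ?_
    exact hc.1.enorm.comp_snd.mul (aestronglyMeasurable_comp_sub_delay hδ hum).enorm
  refine (ae_lt_top' (hm.restrict.pow_const 2) hfin.ne).mono fun t ht => ?_
  by_contra hcon
  rw [not_lt_top_iff] at hcon
  simp [hcon] at ht

theorem UnifLocL2.ae_integrable (hc : Integrable c μ) (hδ : Measurable δ) {u : ℝ → ℝ}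
    (hu : UnifLocL2 u) : ∀ᵐ t : ℝ, Integrable (fun x => c x * u (t - δ x)) μ := by
  filter_upwards [hu.absDelayConv_lt_top hc hδ,
    (aestronglyMeasurable_weighted hc.1 hδ hu.1).prodMk_left] with t ht hm
  refine ⟨hm, ?_⟩
  simpa only [HasFiniteIntegral, enorm_mul, absDelayConv] using ht

end DelayConvolution

/-! ## The linear element as a convolution with weighted delays -/

theorem measurableEmbedding_sum_inl {α β : Type*} [MeasurableSpace α] [MeasurableSpace β] :
    MeasurableEmbedding (Sum.inl : α → α ⊕ β) :=
  ⟨Sum.inl_injective, measurable_inl, fun _ hs => measurableSet_inl_image.2 hs⟩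

theorem measurableEmbedding_sum_inr {α β : Type*} [MeasurableSpace α] [MeasurableSpace β] :
    MeasurableEmbedding (Sum.inr : β → α ⊕ β) :=
  ⟨Sum.inr_injective, measurable_inr, fun _ hs => measurableSet_inr_image.2 hs⟩

namespace StableLTI

/-- The index space of the atoms and of the absolutely continuous part of the impulse response. -/
def measure : Measure (ℕ ⊕ ℝ) :=
  (Measure.count : Measure ℕ).map Sum.inl + (volume.restrict (Ici (0 : ℝ))).map Sum.inr

instance : SFinite measure := by unfold measure; infer_instance

variable (G : StableLTI)

/-- The weights of the impulse response. -/
def weight : ℕ ⊕ ℝ → ℝ := Sum.elim G.coeff G.kernel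

/-- The delays of the impulse response. -/
def lag : ℕ ⊕ ℝ → ℝ := Sum.elim G.delay id

theorem measurable_lag : Measurable G.lag := (measurable_of_countable _).sumElim measurable_id

theorem integrable_iff {E : Type*} [NormedAddCommGroup E] {f : ℕ ⊕ ℝ → E} :
    Integrable f measure ↔
      Summable (fun i => ‖f (Sum.inl i)‖) ∧ IntegrableOn (fun s => f (Sum.inr s)) (Ici 0) := by
  rw [measure, integrable_add_measure, measurableEmbedding_sum_inl.integrable_map_iff,
    measurableEmbedding_sum_inr.integrable_map_iff, integrable_count_iff]
  rfl

theorem integral_eq {E : Type*} [NormedAddCommGroup E] [NormedSpace ℝ E] [CompleteSpace E]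
    {f : ℕ ⊕ ℝ → E} (hf : Integrable f measure) :
    ∫ x, f x ∂measure = (∑' i, f (Sum.inl i)) + ∫ s in Ici (0 : ℝ), f (Sum.inr s) := by
  rw [measure] at hf ⊢
  rw [integral_add_measure hf.left_of_add_measure hf.right_of_add_measure,
    measurableEmbedding_sum_inl.integral_map, measurableEmbedding_sum_inr.integral_map,
    integral_countable]
  · simp [Measure.real]
  · exact (measurableEmbedding_sum_inl.integrable_map_iff).1 hf.left_of_add_measure

theorem integrable_weight : Integrable G.weight measure := by
  rw [integrable_iff]
  exact ⟨by simpa [weight] using G.summable_coeff, by simpa [weight] using G.integrable_kernel⟩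

theorem apply_eq_of_integrable {u : ℝ → ℝ} {t : ℝ}
    (h : Integrable (fun x => G.weight x * u (t - G.lag x)) measure) :
    G.apply u t = delayConv measure G.weight G.lag u t := by
  rw [delayConv, integral_eq h]; rfl

theorem apply_ae_eq {u : ℝ → ℝ} (hu : UnifLocL2 u) :
    G.apply u =ᵐ[volume] delayConv measure G.weight G.lag u := by
  filter_upwards [hu.ae_integrable G.integrable_weight G.measurable_lag] with t ht
  exact G.apply_eq_of_integrable ht

theorem freq_eq (ω : ℝ) : G.freq ω =
    ∫ x, (G.weight x : ℂ) * Complex.exp (-(Complex.I * ω * G.lag x)) ∂measure := by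
  have hm : Measurable fun x => Complex.exp (-(Complex.I * ω * G.lag x)) := by
    have := G.measurable_lag
    fun_prop
  have h : Integrable (fun x => (G.weight x : ℂ) * Complex.exp (-(Complex.I * ω * G.lag x)))
      measure := by
    refine G.integrable_weight.ofReal.mul_bdd (c := 1) hm.aestronglyMeasurable
      (Eventually.of_forall fun x => ?_)
    rw [Complex.norm_exp]; simp
  rw [integral_eq h]; rfl

theorem delay_nonneg' (i : ℕ) : 0 ≤ G.delay i :=
  G.delay_nonneg.trans (G.delay_strictMono.monotone (Nat.zero_le i))

/-- Causality. -/
theorem apply_congr {u v : ℝ → ℝ} {t : ℝ} (h : ∀ s ≤ t, u s = v s) : G.apply u t = G.apply v t := by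
  unfold apply
  congr 1
  · exact tsum_congr fun i => by rw [h _ (by linarith [G.delay_nonneg' i])]
  · exact setIntegral_congr_fun measurableSet_Ici fun s hs => by
      simp only [h (t - s) (by linarith [mem_Ici.1 hs])]

theorem apply_zero (t : ℝ) : G.apply 0 t = 0 := by simp [apply]

theorem apply_neg (u : ℝ → ℝ) (t : ℝ) : G.apply (-u) t = -G.apply u t := by
  simp [apply, tsum_neg, integral_neg]; ring

theorem apply_congr_ae {u v : ℝ → ℝ} (hu : UnifLocL2 u) (hv : UnifLocL2 v)
    (h : u =ᵐ[volume] v) : G.apply u =ᵐ[volume] G.apply v :=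
  ((G.apply_ae_eq hu).trans (delayConv_congr_ae G.measurable_lag h)).trans (G.apply_ae_eq hv).symm

theorem apply_sub_ae {u v : ℝ → ℝ} (hu : UnifLocL2 u) (hv : UnifLocL2 v) :
    ∀ᵐ t, G.apply (u - v) t = G.apply u t - G.apply v t := by
  filter_upwards [hu.ae_integrable G.integrable_weight G.measurable_lag,
    hv.ae_integrable G.integrable_weight G.measurable_lag] with t h1 h2
  rw [G.apply_eq_of_integrable h1, G.apply_eq_of_integrable h2, G.apply_eq_of_integrable, delayConv,
    delayConv, delayConv, ← integral_sub h1 h2]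
  · refine integral_congr_ae (Eventually.of_forall fun x => ?_)
    simp only [Pi.sub_apply]; ring
  · refine (h1.sub h2).congr (Eventually.of_forall fun x => ?_)
    simp only [Pi.sub_apply]; ring

theorem apply_add_ae {u v : ℝ → ℝ} (hu : UnifLocL2 u) (hv : UnifLocL2 v) :
    ∀ᵐ t, G.apply (u + v) t = G.apply u t + G.apply v t := by
  have hv' : UnifLocL2 (-v) :=
    ⟨hv.1.neg, by simpa only [Pi.neg_apply, enorm_neg] using hv.2⟩
  filter_upwards [G.apply_sub_ae hu hv'] with t ht
  rw [sub_neg_eq_add, apply_neg] at ht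
  rw [ht, sub_neg_eq_add]

/-- The total variation of the impulse response. -/
def mass : ℝ≥0∞ := ∫⁻ x, ‖G.weight x‖ₑ ∂measure

theorem mass_lt_top : G.mass < ∞ := G.integrable_weight.2

theorem setLIntegral_sq_apply_le {u : ℝ → ℝ} (hu : UnifLocL2 u) (A : Set ℝ) :
    ∫⁻ t in A, ‖G.apply u t‖ₑ ^ 2 ≤
      G.mass * ∫⁻ x, ‖G.weight x‖ₑ * (∫⁻ t in A, ‖u (t - G.lag x)‖ₑ ^ 2) ∂measure := by
  refine le_trans ?_ (setLIntegral_sq_absDelayConv_le G.integrable_weight.1 G.measurable_lag hu.1 A)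
  refine lintegral_mono_ae ((ae_restrict_of_ae (G.apply_ae_eq hu)).mono fun t ht => ?_)
  simp only [ht]
  exact pow_le_pow_left' (enorm_delayConv_le u t) 2

theorem aestronglyMeasurable_apply {u : ℝ → ℝ} (hu : UnifLocL2 u) :
    AEStronglyMeasurable (G.apply u) volume :=
  (aestronglyMeasurable_delayConv G.integrable_weight.1 G.measurable_lag hu.1).congr
    (G.apply_ae_eq hu).symm

theorem lintegral_sq_apply_le {u : ℝ → ℝ} (hu : MemLp u 2 volume) :
    ∫⁻ t, ‖G.apply u t‖ₑ ^ 2 ≤ G.mass ^ 2 * ∫⁻ t, ‖u t‖ₑ ^ 2 := by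
  have h := G.setLIntegral_sq_apply_le hu.unifLocL2 univ
  simp only [Measure.restrict_univ] at h
  refine h.trans_eq ?_
  have e : ∀ s, ∫⁻ t, ‖u (t - s)‖ₑ ^ 2 = ∫⁻ t, ‖u t‖ₑ ^ 2 := fun s =>
    lintegral_sub_right_eq_self (fun t => ‖u t‖ₑ ^ 2) s
  simp only [e]
  rw [lintegral_mul_const' _ _ (lintegral_enorm_sq_lt_top hu).ne, sq, mul_assoc]
  rfl

theorem memLp_apply {u : ℝ → ℝ} (hu : MemLp u 2 volume) : MemLp (G.apply u) 2 volume := by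
  refine ⟨G.aestronglyMeasurable_apply hu.unifLocL2, ?_⟩
  have h : ∫⁻ t, ‖G.apply u t‖ₑ ^ 2 < ∞ := (G.lintegral_sq_apply_le hu).trans_lt
    (ENNReal.mul_lt_top (ENNReal.pow_lt_top G.mass_lt_top) (lintegral_enorm_sq_lt_top hu))
  rw [lintegral_enorm_sq_eq] at h
  by_contra hcon
  rw [not_lt_top_iff] at hcon
  simp [hcon] at h

end StableLTI

/-! ## Operators on the square integrable signals on the line -/

/-- The square integrable functions on the line. -/
abbrev L2Line (𝕜 : Type*) [RCLike 𝕜] := Lp 𝕜 2 (volume : Measure ℝ)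

section Operators

variable {𝕜 : Type*} [RCLike 𝕜]

/-- Translation by `s`. -/
def translateL2 (𝕜 : Type*) [RCLike 𝕜] (s : ℝ) : L2Line 𝕜 →L[𝕜] L2Line 𝕜 :=
  (Lp.compMeasurePreservingₗᵢ 𝕜 (fun t => t - s)
    (measurePreserving_sub_right volume s)).toContinuousLinearMap

theorem coeFn_translateL2 (s : ℝ) (f : L2Line 𝕜) :
    translateL2 𝕜 s f =ᵐ[volume] fun t => f (t - s) :=
  Lp.coeFn_compMeasurePreserving f (measurePreserving_sub_right volume s)

theorem norm_translateL2 (s : ℝ) (f : L2Line 𝕜) : ‖translateL2 𝕜 s f‖ = ‖f‖ :=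
  LinearIsometry.norm_map _ f

theorem norm_translateL2_le (s : ℝ) : ‖translateL2 𝕜 s‖ ≤ 1 :=
  ContinuousLinearMap.opNorm_le_bound _ zero_le_one fun f => by rw [norm_translateL2, one_mul]

theorem inner_translateL2_translateL2 (f g : L2Line 𝕜) (a b : ℝ) :
    inner 𝕜 (translateL2 𝕜 a f) (translateL2 𝕜 b g) = inner 𝕜 f (translateL2 𝕜 (b - a) g) := by
  rw [L2.inner_def, L2.inner_def]
  have e : ∫ t, inner 𝕜 (f t) (g (t - (b - a))) = ∫ t, inner 𝕜 (f (t - a)) (g (t - a - (b - a))) :=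
    (integral_sub_right_eq_self (fun t => inner 𝕜 (f t) (g (t - (b - a)))) a).symm
  calc _ = ∫ t, inner 𝕜 (f (t - a)) (g (t - a - (b - a))) := by
        refine integral_congr_ae ?_
        filter_upwards [coeFn_translateL2 a f, coeFn_translateL2 b g] with t h1 h2
        rw [h1, h2]; ring_nf
    _ = _ := by
        rw [← e]
        refine integral_congr_ae ?_
        filter_upwards [coeFn_translateL2 (b - a) g] with t h1
        rw [h1]

theorem memLp_bounded_mul {m : ℝ → 𝕜} (hm : Measurable m) (hb : ∀ t, ‖m t‖ ≤ 1)
    (f : L2Line 𝕜) : MemLp (fun t => m t * f t) 2 volume :=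
  (Lp.memLp f).of_le (hm.aestronglyMeasurable.mul (Lp.aestronglyMeasurable f))
    (Eventually.of_forall fun t => by
      rw [norm_mul]; exact mul_le_of_le_one_left (norm_nonneg _) (hb t))

/-- Multiplication by a measurable function that is bounded by one. -/
def mulOp (m : ℝ → 𝕜) (hm : Measurable m) (hb : ∀ t, ‖m t‖ ≤ 1) : L2Line 𝕜 →L[𝕜] L2Line 𝕜 :=
  LinearMap.mkContinuous
    { toFun := fun f => (memLp_bounded_mul hm hb f).toLp _
      map_add' := fun f g => by
        rw [← MemLp.toLp_add, MemLp.toLp_eq_toLp_iff]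
        filter_upwards [Lp.coeFn_add f g] with t ht
        simp only [ht, Pi.add_apply, mul_add]
      map_smul' := fun c f => by
        rw [RingHom.id_apply, ← MemLp.toLp_const_smul, MemLp.toLp_eq_toLp_iff]
        filter_upwards [Lp.coeFn_smul c f] with t ht
        simp only [ht, Pi.smul_apply, smul_eq_mul]; ring }
    1 fun f => by
      rw [one_mul]
      refine Lp.norm_le_norm_of_ae_le ?_
      filter_upwards [(memLp_bounded_mul hm hb f).coeFn_toLp] with t ht
      simp only [LinearMap.coe_mk, AddHom.coe_mk]
      rw [ht, norm_mul]; exact mul_le_of_le_one_left (norm_nonneg _) (hb t)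

theorem coeFn_mulOp (m : ℝ → 𝕜) (hm : Measurable m) (hb : ∀ t, ‖m t‖ ≤ 1) (f : L2Line 𝕜) :
    mulOp m hm hb f =ᵐ[volume] fun t => m t * f t :=
  (memLp_bounded_mul hm hb f).coeFn_toLp

theorem norm_mulOp_le (m : ℝ → 𝕜) (hm : Measurable m) (hb : ∀ t, ‖m t‖ ≤ 1) :
    ‖mulOp m hm hb‖ ≤ 1 :=
  by unfold mulOp; exact LinearMap.mkContinuous_norm_le _ zero_le_one _

end Operators

/-! ## The spectral measure of a square integrable signal -/

section Spectral

open FourierTransform SchwartzMap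

/-- The character `ξ ↦ exp (-2πisξ)`. -/
def phase (s ξ : ℝ) : ℂ := Complex.exp (-(Complex.I * (2 * Real.pi * ξ : ℝ) * s))

theorem measurable_phase (s : ℝ) : Measurable (phase s) := by unfold phase; fun_prop

theorem norm_phase (s ξ : ℝ) : ‖phase s ξ‖ = 1 := by
  rw [phase, Complex.norm_exp]; simp

/-- Both sides are continuous in `f`, so it suffices to check Schwartz functions, where this is the
classical rule for the Fourier integral of a translate. -/
theorem fourier_translateL2 (s : ℝ) (f : L2Line ℂ) :
    𝓕 (translateL2 ℂ s f) =
      mulOp (phase s) (measurable_phase s) (fun ξ => (norm_phase s ξ).le) (𝓕 f) := by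
  have hF : Continuous fun g : L2Line ℂ => (𝓕 g : L2Line ℂ) :=
    (Lp.fourierTransformₗᵢ ℝ ℂ).continuous
  refine DenseRange.induction_on (p := fun f : L2Line ℂ => 𝓕 (translateL2 ℂ s f) =
      mulOp (phase s) (measurable_phase s) (fun ξ => (norm_phase s ξ).le) (𝓕 f))
    (SchwartzMap.denseRange_toLpCLM (E := ℝ) (F := ℂ) (p := 2) ENNReal.ofNat_ne_top) f ?_ ?_
  · exact isClosed_eq (hF.comp (translateL2 ℂ s).continuous)
      ((mulOp (phase s) _ _).continuous.comp hF)
  · intro φ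
    have h1 : translateL2 ℂ s (toLpCLM ℝ ℂ 2 volume φ) =
        (φ.compSubConstCLM ℝ s).toLp 2 := by
      refine Lp.ext ?_
      filter_upwards [coeFn_translateL2 s (toLpCLM ℝ ℂ 2 volume φ),
        (measurePreserving_sub_right volume s).quasiMeasurePreserving.ae (φ.coeFn_toLp 2 volume),
        (φ.compSubConstCLM ℝ s).coeFn_toLp 2 volume] with t ht1 ht2 ht3
      rw [ht1, ht3, toLpCLM_apply, ht2]; rfl
    rw [h1, toLpCLM_apply, SchwartzMap.toLp_fourier_eq, SchwartzMap.toLp_fourier_eq]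
    refine Lp.ext ?_
    filter_upwards [coeFn_mulOp (phase s) (measurable_phase s) (fun ξ => (norm_phase s ξ).le)
      ((𝓕 φ).toLp 2), (𝓕 φ).coeFn_toLp 2 volume,
      (𝓕 (φ.compSubConstCLM ℝ s)).coeFn_toLp 2 volume] with ξ h1 h2 h3
    rw [h1, h2, h3, fourier_coe, fourier_coe]
    have := congrFun (VectorFourier.fourierIntegral_comp_add_right Real.fourierChar volume
      (innerₗ ℝ) (φ : ℝ → ℂ) (-s)) ξ
    refine Eq.trans ?_ (this.trans ?_)
    · rfl
    · rw [Circle.smul_def, Real.fourierChar_apply, smul_eq_mul]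
      congr 1
      rw [phase]
      congr 1
      simp
      ring

theorem inner_translateL2_eq_integral (s : ℝ) (f : L2Line ℂ) :
    inner ℂ f (translateL2 ℂ s f) = ∫ ξ, phase s ξ * ((‖(𝓕 f : L2Line ℂ) ξ‖ ^ 2 : ℝ) : ℂ) := by
  rw [← Lp.inner_fourier_eq, fourier_translateL2, L2.inner_def]
  refine integral_congr_ae ?_
  filter_upwards [coeFn_mulOp (phase s) (measurable_phase s) (fun ξ => (norm_phase s ξ).le)
    (𝓕 f)] with ξ h
  rw [h, RCLike.inner_apply, mul_assoc, RCLike.mul_conj]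
  norm_cast

/-- The autocorrelation of a square integrable signal is the Fourier transform of a finite
measure. -/
theorem exists_spectral_measure (f : L2Line ℝ) : ∃ ν : Measure ℝ, IsFiniteMeasure ν ∧
    ∀ s : ℝ, ((inner ℝ f (translateL2 ℝ s f) : ℝ) : ℂ) =
      ∫ ω, Complex.exp (-(Complex.I * ω * s)) ∂ν := by
  -- The measure has density `|𝓕 g|²` for the complexification `g`. Pushing it forward along `ξ ↦
  -- 2πξ` converts frequency to angular frequency.
  let g : L2Line ℂ := Complex.ofRealCLM.compLp f
  have hg : g =ᵐ[volume] fun t => (f t : ℂ) := Complex.ofRealCLM.coeFn_compLp f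
  let F : L2Line ℂ := 𝓕 g
  have hm : AEMeasurable (fun ξ => ‖F ξ‖₊ ^ 2) volume :=
    (Lp.aestronglyMeasurable F).nnnorm.aemeasurable.pow_const 2
  let ν₀ : Measure ℝ := volume.withDensity fun ξ => ((‖F ξ‖₊ ^ 2 : ℝ≥0) : ℝ≥0∞)
  have hfin : IsFiniteMeasure ν₀ := by
    refine isFiniteMeasure_withDensity ?_
    have := (Lp.memLp F).2
    rw [eLpNorm_eq_lintegral_rpow_enorm_toReal (by norm_num) (by norm_num)] at this
    have h2 := ENNReal.rpow_lt_top_of_nonneg (y := 2) (by norm_num) this.ne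
    rw [← ENNReal.rpow_mul] at h2
    norm_num at h2
    refine ne_of_lt (lt_of_eq_of_lt (lintegral_congr fun ξ => ?_) h2)
    rw [ENNReal.coe_pow]; rfl
  have hmul : Measurable fun ξ : ℝ => 2 * Real.pi * ξ := by fun_prop
  refine ⟨ν₀.map fun ξ => 2 * Real.pi * ξ, Measure.isFiniteMeasure_map _ _, fun s => ?_⟩
  rw [integral_map hmul.aemeasurable (by fun_prop),
    integral_withDensity_eq_integral_smul₀ hm]
  have h1 : ((inner ℝ f (translateL2 ℝ s f) : ℝ) : ℂ) = inner ℂ g (translateL2 ℂ s g) := by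
    rw [L2.inner_def, L2.inner_def, ← integral_complex_ofReal]
    refine integral_congr_ae ?_
    filter_upwards [hg, coeFn_translateL2 s f, coeFn_translateL2 s g,
      (measurePreserving_sub_right volume s).quasiMeasurePreserving.ae hg] with t h1 h2 h3 h4
    rw [h1, h2, h3, h4]
    simp
  rw [h1, inner_translateL2_eq_integral]
  refine integral_congr_ae (Eventually.of_forall fun ξ => ?_)
  simp only [phase, NNReal.smul_def, F]
  push_cast
  rw [mul_comm]
  simp

end Spectral

/-! ## Multipliers as operators, and their frequency-domain quadratic form -/

theorem translateL2_translateL2 {𝕜 : Type*} [RCLike 𝕜] (a b : ℝ) (f : L2Line 𝕜) :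
    translateL2 𝕜 a (translateL2 𝕜 b f) = translateL2 𝕜 (a + b) f := by
  refine Lp.ext ?_
  filter_upwards [coeFn_translateL2 a (translateL2 𝕜 b f), coeFn_translateL2 (a + b) f,
    (measurePreserving_sub_right volume a).quasiMeasurePreserving.ae (coeFn_translateL2 b f)]
    with t h1 h2 h3
  rw [h1, h2, h3]; ring_nf

theorem translateL2_zero {𝕜 : Type*} [RCLike 𝕜] (f : L2Line 𝕜) : translateL2 𝕜 0 f = f := by
  refine Lp.ext ?_
  filter_upwards [coeFn_translateL2 0 f] with t h1
  rw [h1, sub_zero]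

theorem inner_translateL2_right {𝕜 : Type*} [RCLike 𝕜] (a : ℝ) (f g : L2Line 𝕜) :
    inner 𝕜 f (translateL2 𝕜 a g) = inner 𝕜 (translateL2 𝕜 (-a) f) g := by
  have := inner_translateL2_translateL2 f g 0 a
  rw [translateL2_zero, sub_zero] at this
  have h2 := inner_translateL2_translateL2 f g (-a) 0
  rw [translateL2_zero, zero_sub, neg_neg] at h2
  rw [this, h2]

/-- The oscillation `exp (-jωs)`. -/
def osc (ω s : ℝ) : ℂ := Complex.exp (-(Complex.I * ω * s))

theorem norm_osc (ω s : ℝ) : ‖osc ω s‖ = 1 := by rw [osc, Complex.norm_exp]; simp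

theorem osc_add (ω a b : ℝ) : osc ω (a + b) = osc ω a * osc ω b := by
  rw [osc, osc, osc, ← Complex.exp_add]; push_cast; ring_nf

theorem continuous_osc : Continuous fun p : ℝ × ℝ => osc p.1 p.2 := by unfold osc; fun_prop

theorem conj_osc (ω s : ℝ) : (starRingEnd ℂ) (osc ω s) = osc ω (-s) := by
  rw [osc, osc, ← Complex.exp_conj]; simp

theorem osc_zero (ω : ℝ) : osc ω 0 = 1 := by simp [osc]

theorem hasSum_clm_apply {ι E : Type*} [NormedAddCommGroup E] [NormedSpace ℝ E]
    {A : ι → E →L[ℝ] E} {B : E →L[ℝ] E} (h : HasSum A B) (f : E) :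
    HasSum (fun n => A n f) (B f) :=
  (ContinuousLinearMap.apply ℝ E f).hasSum h

namespace AltshullerMultiplier

variable {T : ℝ} (M : AltshullerMultiplier T)

theorem freq_eq (ω : ℝ) : M.freq ω = 1 - ∑' n : ℤ, (M.h n : ℂ) * osc ω (n * T) := by
  simp [freq, osc]

theorem norm_term (ω : ℝ) (n : ℤ) (s : ℝ) : ‖(M.h n : ℂ) * osc ω s‖ = M.h n := by
  rw [norm_mul, norm_osc, mul_one, Complex.norm_real, Real.norm_of_nonneg (M.h_nonneg n)]

theorem continuous_freq : Continuous M.freq := by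
  have : M.freq = fun ω => 1 - ∑' n : ℤ, (M.h n : ℂ) * osc ω (n * T) := funext M.freq_eq
  rw [this]
  refine continuous_const.sub (continuous_tsum (fun n => ?_) M.summable_h fun n ω => ?_)
  · exact continuous_const.mul (continuous_osc.comp (by fun_prop : Continuous fun ω : ℝ => (ω, (n * T : ℝ))))
  · rw [norm_term]

theorem norm_freq_le (ω : ℝ) : ‖M.freq ω‖ ≤ 2 := by
  rw [freq_eq]
  refine (norm_sub_le _ _).trans ?_
  have : ‖∑' n : ℤ, (M.h n : ℂ) * osc ω (n * T)‖ ≤ ∑' n, M.h n :=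
    tsum_of_norm_bounded M.summable_h.hasSum fun n => (M.norm_term _ _ _).le
  rw [norm_one]
  linarith [M.sum_lt_one]

/-- The operator `∑ₙ hₙ S_{nT}`, where `S` denotes translation. -/
def delayOp : L2Line ℝ →L[ℝ] L2Line ℝ := ∑' n : ℤ, M.h n • translateL2 ℝ (n * T)

theorem norm_smul_translateL2_le (n : ℤ) (s : ℝ) : ‖M.h n • translateL2 ℝ s‖ ≤ M.h n := by
  rw [norm_smul, Real.norm_of_nonneg (M.h_nonneg n)]
  exact mul_le_of_le_one_right (M.h_nonneg n) (norm_translateL2_le s)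

theorem summable_delayOp : Summable fun n : ℤ => M.h n • translateL2 ℝ (n * T) :=
  Summable.of_norm_bounded M.summable_h fun n => M.norm_smul_translateL2_le n _

/-- Translations are isometries, so the strict inequality on the weights makes this operator a
contraction; all continuations past `τ` rest on this. -/
theorem norm_delayOp_lt_one : ‖M.delayOp‖ < 1 :=
  (tsum_of_norm_bounded M.summable_h.hasSum fun n =>
    M.norm_smul_translateL2_le n _).trans_lt M.sum_lt_one

theorem hasSum_delayOp (f : L2Line ℝ) :
    HasSum (fun n : ℤ => M.h n • translateL2 ℝ (n * T) f) (M.delayOp f) :=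
  hasSum_clm_apply M.summable_delayOp.hasSum f

theorem hasSum_inner_delayOp (g f : L2Line ℝ) :
    HasSum (fun n : ℤ => M.h n * inner ℝ g (translateL2 ℝ (n * T) f))
      (inner ℝ g (M.delayOp f)) := by
  have := (innerSL ℝ g).hasSum (M.hasSum_delayOp f)
  simpa [inner_smul_right] using this

/-- The multiplier as an operator. -/
def op : L2Line ℝ →L[ℝ] L2Line ℝ := 1 - M.delayOp

/-- The adjoint of the multiplier. -/
def adj : L2Line ℝ →L[ℝ] L2Line ℝ := ContinuousLinearMap.adjoint M.op

theorem inner_adj_left (f g : L2Line ℝ) : inner ℝ (M.adj f) g = inner ℝ f (M.op g) :=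
  ContinuousLinearMap.adjoint_inner_left _ _ _

/-- Moves the adjoint onto translates of `g`, so that pairings with `M* f` become series of
correlations, accessible to the spectral measure. -/
theorem hasSum_inner_adj (f g : L2Line ℝ) :
    HasSum (fun n : ℤ => M.h n * inner ℝ f (translateL2 ℝ (n * T) g))
      (inner ℝ f g - inner ℝ (M.adj f) g) := by
  have : inner ℝ f g - inner ℝ (M.adj f) g = inner ℝ f (M.delayOp g) := by
    rw [inner_adj_left, op, sub_apply, inner_sub_right]
    simp
  rw [this]
  exact M.hasSum_inner_delayOp f g

section Spectral

variable {ν : Measure ℝ} [IsFiniteMeasure ν]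

theorem integrable_of_bounded {g : ℝ → ℂ} (hg : Continuous g) {C : ℝ} (hC : ∀ ω, ‖g ω‖ ≤ C) :
    Integrable g ν :=
  Integrable.of_bound hg.aestronglyMeasurable C (Eventually.of_forall hC)

/-- The series is dominated by `hₙ ∫ |g|`. The sign `σ = 1` produces the symbol `1 - M`, and `σ =
-1` its conjugate. -/
theorem hasSum_integral_term {g : ℝ → ℂ} (hg : Continuous g) {C : ℝ} (hC : ∀ ω, ‖g ω‖ ≤ C)
    (σ : ℝ) :
    HasSum (fun n : ℤ => (M.h n : ℂ) * ∫ ω, osc ω (σ * (n * T)) * g ω ∂ν)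
      (∫ ω, (∑' n : ℤ, (M.h n : ℂ) * osc ω (σ * (n * T))) * g ω ∂ν) := by
  have hc : ∀ s : ℝ, Continuous fun ω => osc ω s * g ω := fun s =>
    (continuous_osc.comp (by fun_prop : Continuous fun ω : ℝ => (ω, s))).mul hg
  have hb : ∀ s ω : ℝ, ‖osc ω s * g ω‖ ≤ C := fun s ω => by
    rw [norm_mul, norm_osc, one_mul]; exact hC ω
  have h := hasSum_integral_of_summable_integral_norm (μ := ν)
    (F := fun (n : ℤ) ω => (M.h n : ℂ) * (osc ω (σ * (n * T)) * g ω))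
    (fun n => (integrable_of_bounded (hc _) (hb _)).const_mul _) ?_
  · simp only [integral_const_mul] at h
    simpa only [← mul_assoc, tsum_mul_right] using h
  · refine Summable.of_nonneg_of_le (fun n => integral_nonneg fun ω => norm_nonneg _) (fun n => ?_)
      (M.summable_h.mul_right (∫ ω, ‖g ω‖ ∂ν))
    rw [← integral_const_mul]
    refine le_of_eq (integral_congr_ae (Eventually.of_forall fun ω => ?_))
    simp only [← mul_assoc]
    rw [norm_mul, norm_term]

variable {f : L2Line ℝ} (hν : ∀ s : ℝ, ((inner ℝ f (translateL2 ℝ s f) : ℝ) : ℂ) = ∫ ω, osc ω s ∂ν)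
include hν

/-- Expanding the adjoint gives the autocorrelation of `f` at `s` minus its weighted values at `nT +
s`; under the spectral integral these combine into the factor `M`. -/
theorem inner_adj_translateL2 (s : ℝ) :
    ((inner ℝ (M.adj f) (translateL2 ℝ s f) : ℝ) : ℂ) = ∫ ω, osc ω s * M.freq ω ∂ν := by
  have h1 := (M.hasSum_inner_adj f (translateL2 ℝ s f)).mapL Complex.ofRealCLM
  have hc : Continuous fun ω => osc ω s :=
    continuous_osc.comp (by fun_prop : Continuous fun ω : ℝ => (ω, s))
  have h2 := M.hasSum_integral_term (ν := ν) (g := fun ω => osc ω s) hc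
    (fun ω => (norm_osc ω s).le) 1
  have h3 : (fun n : ℤ => Complex.ofRealCLM (M.h n * inner ℝ f (translateL2 ℝ (n * T)
      (translateL2 ℝ s f)))) =
      fun n : ℤ => (M.h n : ℂ) * ∫ ω, osc ω (1 * (n * T)) * osc ω s ∂ν := by
    funext n
    rw [translateL2_translateL2, Complex.ofRealCLM_apply, Complex.ofReal_mul, hν]
    simp only [one_mul, osc_add]
  rw [h3] at h1
  have h4 := h1.unique h2
  rw [Complex.ofRealCLM_apply, Complex.ofReal_sub, hν] at h4
  rw [sub_eq_iff_eq_add, ← sub_eq_iff_eq_add'] at h4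
  rw [← h4, ← integral_sub]
  · refine integral_congr_ae (Eventually.of_forall fun ω => ?_)
    simp only [M.freq_eq, one_mul]
    ring
  · exact integrable_of_bounded hc fun ω => (norm_osc ω s).le
  · have : (fun ω => (∑' n : ℤ, (M.h n : ℂ) * osc ω (1 * (n * T))) * osc ω s) =
        fun ω => (1 - M.freq ω) * osc ω s := by
      funext ω; simp only [M.freq_eq, one_mul]; ring
    rw [this]
    refine integrable_of_bounded ((continuous_const.sub M.continuous_freq).mul hc) (C := 3)
      fun ω => ?_
    rw [norm_mul, norm_osc, mul_one]
    refine (norm_sub_le _ _).trans ?_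
    rw [norm_one]; linarith [M.norm_freq_le ω]

/-- Expanding one of the two copies of `M* f` and moving the translations back to `f` reduces to the
previous correlations at `-nT`. The integrand becomes `M - (1 - conj M) M = |M|²`. -/
theorem norm_adj_sq :
    ((‖M.adj f‖ ^ 2 : ℝ) : ℂ) = ∫ ω, ((‖M.freq ω‖ ^ 2 : ℝ) : ℂ) ∂ν := by
  have h1 := (M.hasSum_inner_adj f (M.adj f)).mapL Complex.ofRealCLM
  have h2 := M.hasSum_integral_term (ν := ν) M.continuous_freq M.norm_freq_le (-1)
  have h3 : (fun n : ℤ => Complex.ofRealCLM (M.h n * inner ℝ f (translateL2 ℝ (n * T)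
      (M.adj f)))) =
      fun n : ℤ => (M.h n : ℂ) * ∫ ω, osc ω (-1 * (n * T)) * M.freq ω ∂ν := by
    funext n
    rw [inner_translateL2_right, real_inner_comm, Complex.ofRealCLM_apply, Complex.ofReal_mul,
      M.inner_adj_translateL2 hν, neg_one_mul]
  rw [h3] at h1
  have h4 := h1.unique h2
  have h5 := M.inner_adj_translateL2 hν 0
  simp only [translateL2_zero, osc_zero, one_mul] at h5
  rw [Complex.ofRealCLM_apply, Complex.ofReal_sub, real_inner_comm, h5,
    real_inner_self_eq_norm_sq, sub_eq_iff_eq_add, ← sub_eq_iff_eq_add'] at h4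
  have hconj : ∀ ω, ∑' n : ℤ, (M.h n : ℂ) * osc ω (-1 * (n * T)) =
      1 - (starRingEnd ℂ) (M.freq ω) := by
    intro ω
    rw [M.freq_eq, map_sub, map_one, sub_sub_cancel, Complex.conj_tsum]
    refine tsum_congr fun n => ?_
    rw [map_mul, conj_osc, Complex.conj_ofReal, neg_one_mul]
  simp only [hconj] at h4
  rw [← h4, ← integral_sub]
  · refine integral_congr_ae (Eventually.of_forall fun ω => ?_)
    simp only
    rw [Complex.ofReal_pow, ← Complex.conj_mul']
    ring
  · exact integrable_of_bounded M.continuous_freq M.norm_freq_le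
  · refine integrable_of_bounded ((continuous_const.sub
      (Complex.continuous_conj.comp M.continuous_freq)).mul M.continuous_freq) (C := 3 * 2)
      fun ω => ?_
    rw [norm_mul]
    refine mul_le_mul ((norm_sub_le _ _).trans ?_) (M.norm_freq_le ω) (norm_nonneg _) (by norm_num)
    rw [norm_one, RCLike.norm_conj]; linarith [M.norm_freq_le ω]

end Spectral

end AltshullerMultiplier

theorem L2Line.integral_mul (f g : L2Line ℝ) : ∫ t, f t * g t = inner ℝ f g := by
  rw [L2.inner_def]
  exact integral_congr_ae (Eventually.of_forall fun t => by simp [mul_comm])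

theorem L2Line.integrable_mul (f g : L2Line ℝ) : Integrable (fun t => f t * g t) := by
  simpa [mul_comm] using L2.integrable_inner (𝕜 := ℝ) f g

/-! ### Pairing a signal with a convolution, and the frequency-domain inequality -/

section Fubini

variable {X : Type*} [MeasurableSpace X] {μ : Measure X} [SFinite μ] {c δ : X → ℝ}

/-- The time integral of the absolute value is at most `|c x| (‖m‖² + ‖f‖²)`, uniformly in the
delay, because translations preserve the norm. -/
theorem integrable_mul_weighted (hc : Integrable c μ) (hδ : Measurable δ) (m f : L2Line ℝ) :
    Integrable (fun p : ℝ × X => m p.1 * (c p.2 * f (p.1 - δ p.2))) (volume.prod μ) := by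
  have hm : AEStronglyMeasurable (fun p : ℝ × X => m p.1 * (c p.2 * f (p.1 - δ p.2)))
      (volume.prod μ) :=
    (Lp.aestronglyMeasurable m).comp_fst.mul
      (aestronglyMeasurable_weighted hc.1 hδ (Lp.aestronglyMeasurable f))
  have hT : ∀ x, (fun t => m t * (c x * f (t - δ x))) =ᵐ[volume]
      fun t => c x * (m t * translateL2 ℝ (δ x) f t) := fun x => by
    filter_upwards [coeFn_translateL2 (δ x) f] with t ht
    rw [ht]; ring
  rw [integrable_prod_iff' hm]
  refine ⟨Eventually.of_forall fun x => ?_, ?_⟩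
  · exact ((L2Line.integrable_mul m (translateL2 ℝ (δ x) f)).const_mul (c x)).congr (hT x).symm
  · refine Integrable.mono' (hc.norm.mul_const (‖m‖ ^ 2 + ‖f‖ ^ 2)) ?_
      (Eventually.of_forall fun x => ?_)
    · exact hm.norm.prod_swap.integral_prod_right'
    · rw [Real.norm_of_nonneg (integral_nonneg fun t => norm_nonneg _)]
      have e : ∫ t, ‖m t * (c x * f (t - δ x))‖ =
          ‖c x‖ * ∫ t, ‖m t * translateL2 ℝ (δ x) f t‖ := by
        rw [← integral_const_mul]
        refine integral_congr_ae ((hT x).mono fun t ht => ?_)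
        simp only at ht ⊢
        rw [ht, norm_mul]
      rw [e]
      refine mul_le_mul_of_nonneg_left ?_ (norm_nonneg _)
      have h1 := L2Line.integral_mul m m
      have h2 := L2Line.integral_mul (translateL2 ℝ (δ x) f) (translateL2 ℝ (δ x) f)
      rw [real_inner_self_eq_norm_sq] at h1 h2
      rw [norm_translateL2] at h2
      rw [← h1, ← h2, ← integral_add (L2Line.integrable_mul _ _) (L2Line.integrable_mul _ _)]
      refine integral_mono (L2Line.integrable_mul _ _).norm
        ((L2Line.integrable_mul _ _).add (L2Line.integrable_mul _ _)) fun t => ?_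
      simp only
      rw [norm_mul, Real.norm_eq_abs, Real.norm_eq_abs, ← abs_mul_abs_self (m t),
        ← abs_mul_abs_self (translateL2 ℝ (δ x) f t)]
      nlinarith [sq_nonneg (|m t| - |translateL2 ℝ (δ x) f t|), abs_nonneg (m t),
        abs_nonneg (translateL2 ℝ (δ x) f t),
        mul_nonneg (abs_nonneg (m t)) (abs_nonneg (translateL2 ℝ (δ x) f t))]

theorem integral_mul_delayConv (hc : Integrable c μ) (hδ : Measurable δ) (m f : L2Line ℝ) :
    ∫ t, m t * delayConv μ c δ f t = ∫ x, c x * inner ℝ m (translateL2 ℝ (δ x) f) ∂μ := by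
  simp only [delayConv, ← integral_const_mul]
  rw [integral_integral_swap (integrable_mul_weighted hc hδ m f)]
  refine integral_congr_ae (Eventually.of_forall fun x => ?_)
  simp only
  rw [← L2Line.integral_mul, ← integral_const_mul]
  refine integral_congr_ae ?_
  filter_upwards [coeFn_translateL2 (δ x) f] with t ht
  rw [ht]; ring

end Fubini

theorem StableLTI.integral_mul_apply (G : StableLTI) (m f : L2Line ℝ) :
    ∫ t, m t * G.apply f t =
      ∫ x, G.weight x * inner ℝ m (translateL2 ℝ (G.lag x) f) ∂StableLTI.measure := by
  rw [← integral_mul_delayConv G.integrable_weight G.measurable_lag]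
  refine integral_congr_ae ?_
  filter_upwards [G.apply_ae_eq (Lp.memLp f).unifLocL2] with t ht
  rw [ht]

theorem quadratic_form_bound (G : StableLTI) {T : ℝ} (M : AltshullerMultiplier T) {κ h : ℝ}
    (hh : ∀ ω, 1 + ‖M.freq ω‖ ^ 2 ≤ 2 * h * (M.freq ω * (κ + G.freq ω)).re) (f : L2Line ℝ) :
    ‖f‖ ^ 2 + ‖M.adj f‖ ^ 2 ≤
      2 * h * (κ * inner ℝ (M.adj f) f + ∫ t, M.adj f t * G.apply f t) := by
  obtain ⟨ν, hνf, hν⟩ := exists_spectral_measure f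
  change ∀ s : ℝ, _ = ∫ ω, osc ω s ∂ν at hν
  -- Joint integrability allows the impulse response and the spectral measure to be integrated in
  -- either order; the bound `2` is that of `|M|`.
  have hint : Integrable (fun p : (ℕ ⊕ ℝ) × ℝ =>
      (G.weight p.1 : ℂ) * (osc p.2 (G.lag p.1) * M.freq p.2)) (StableLTI.measure.prod ν) := by
    have hw : Integrable (fun p : (ℕ ⊕ ℝ) × ℝ => (G.weight p.1 : ℂ)) (StableLTI.measure.prod ν) :=
      (G.integrable_weight.comp_fst ν).ofReal
    refine hw.mul_bdd (c := 2) ?_ (Eventually.of_forall fun p => ?_)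
    · have := G.measurable_lag
      have h1 : Measurable fun p : (ℕ ⊕ ℝ) × ℝ => osc p.2 (G.lag p.1) :=
        continuous_osc.measurable.comp (by fun_prop : Measurable fun p : (ℕ ⊕ ℝ) × ℝ =>
          (p.2, G.lag p.1))
      exact (h1.mul (M.continuous_freq.measurable.comp measurable_snd)).aestronglyMeasurable
    · rw [norm_mul, norm_osc, one_mul]; exact M.norm_freq_le _
  have hGfreq : ∀ ω, ∫ x, (G.weight x : ℂ) * (osc ω (G.lag x) * M.freq ω) ∂StableLTI.measure =
      M.freq ω * G.freq ω := fun ω => by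
    rw [G.freq_eq, mul_comm, ← integral_mul_const]
    simp only [osc, mul_assoc]
  have hMG : Integrable (fun ω => M.freq ω * G.freq ω) ν := by
    simpa only [Function.comp_apply, Prod.swap_prod_mk, hGfreq] using hint.swap.integral_prod_left
  have e1 : ((∫ t, M.adj f t * G.apply f t : ℝ) : ℂ) = ∫ ω, M.freq ω * G.freq ω ∂ν := by
    rw [G.integral_mul_apply, ← integral_complex_ofReal]
    simp only [Complex.ofReal_mul, M.inner_adj_translateL2 hν, ← integral_const_mul]
    rw [integral_integral_swap hint]
    simp only [hGfreq]
  have e2 : ((inner ℝ (M.adj f) f : ℝ) : ℂ) = ∫ ω, M.freq ω ∂ν := by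
    have := M.inner_adj_translateL2 hν 0
    simpa only [translateL2_zero, osc_zero, one_mul] using this
  have e3 : ((‖f‖ ^ 2 : ℝ) : ℂ) = ∫ ω, 1 ∂ν := by
    have := hν 0
    simpa only [translateL2_zero, osc_zero, real_inner_self_eq_norm_sq] using this
  have e4 := M.norm_adj_sq hν
  have iM : Integrable M.freq ν :=
    AltshullerMultiplier.integrable_of_bounded M.continuous_freq M.norm_freq_le
  have iN : Integrable (fun ω => ((‖M.freq ω‖ ^ 2 : ℝ) : ℂ)) ν := by
    refine AltshullerMultiplier.integrable_of_bounded (C := 4)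
      (Complex.continuous_ofReal.comp (M.continuous_freq.norm.pow 2)) fun ω => ?_
    rw [Complex.norm_real, Real.norm_of_nonneg (by positivity)]
    nlinarith [M.norm_freq_le ω, norm_nonneg (M.freq ω)]
  have i1 : Integrable (fun _ : ℝ => (1 : ℂ)) ν := integrable_const _
  have iA : Integrable (fun ω => (κ : ℂ) * M.freq ω + M.freq ω * G.freq ω) ν :=
    (iM.const_mul _).add hMG
  have iB : Integrable (fun ω => 1 + ((‖M.freq ω‖ ^ 2 : ℝ) : ℂ)) ν := i1.add iN
  have iC : Integrable (fun ω => 2 * (h : ℂ) * (κ * M.freq ω + M.freq ω * G.freq ω)) ν :=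
    iA.const_mul _
  -- All terms are integrals against the same spectral measure, so the difference of the two sides
  -- is the integral of a symbol whose real part is nonnegative by `hh`.
  have key : ((2 * h * (κ * inner ℝ (M.adj f) f + ∫ t, M.adj f t * G.apply f t) -
      (‖f‖ ^ 2 + ‖M.adj f‖ ^ 2) : ℝ) : ℂ) =
      ∫ ω, (2 * h * (κ * M.freq ω + M.freq ω * G.freq ω) -
        (1 + ((‖M.freq ω‖ ^ 2 : ℝ) : ℂ))) ∂ν := by
    rw [integral_sub iC iB, integral_const_mul,
      integral_add (iM.const_mul _) hMG, integral_const_mul, integral_add i1 iN, ← e1, ← e2, ← e3,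
      ← e4]
    push_cast; ring
  have key2 := congrArg Complex.re key
  rw [Complex.ofReal_re] at key2
  have hre := integral_re (iC.sub iB)
  have hpos : 0 ≤ (∫ ω, (2 * h * (κ * M.freq ω + M.freq ω * G.freq ω) -
        (1 + ((‖M.freq ω‖ ^ 2 : ℝ) : ℂ))) ∂ν).re := by
    refine le_of_le_of_eq (integral_nonneg fun ω => ?_) hre
    have := hh ω
    simp only [Pi.zero_apply, Pi.sub_apply, RCLike.re_to_complex]
    have e5 : (2 * (h : ℂ) * (κ * M.freq ω + M.freq ω * G.freq ω) -
        (1 + ((‖M.freq ω‖ ^ 2 : ℝ) : ℂ))) =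
        ((2 * h : ℝ) : ℂ) * (M.freq ω * (κ + G.freq ω)) - ((1 + ‖M.freq ω‖ ^ 2 : ℝ) : ℂ) := by
      push_cast; ring
    rw [e5, Complex.sub_re, Complex.re_ofReal_mul, Complex.ofReal_re]
    linarith
  linarith

/-! ## Restriction of signals to sets -/

theorem norm_indicator_one_le (A : Set ℝ) (t : ℝ) : ‖A.indicator (1 : ℝ → ℝ) t‖ ≤ 1 := by
  by_cases h : t ∈ A <;> simp [h]

/-- Restriction of a signal to the set `A`. -/
def restr (A : Set ℝ) (hA : MeasurableSet A) : L2Line ℝ →L[ℝ] L2Line ℝ :=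
  mulOp (A.indicator 1) (measurable_one.indicator hA) (norm_indicator_one_le A)

section Restr

variable {A B : Set ℝ} (hA : MeasurableSet A) (hB : MeasurableSet B)

theorem coeFn_restr (f : L2Line ℝ) : restr A hA f =ᵐ[volume] A.indicator f := by
  filter_upwards [coeFn_mulOp (A.indicator 1) (measurable_one.indicator hA)
    (norm_indicator_one_le A) f] with t ht
  rw [restr, ht]
  by_cases h : t ∈ A <;> simp [h]

theorem norm_restr_le : ‖restr A hA‖ ≤ 1 := norm_mulOp_le _ _ _

theorem restr_restr (f : L2Line ℝ) : restr A hA (restr B hB f) = restr (A ∩ B) (hA.inter hB) f := by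
  refine Lp.ext ?_
  filter_upwards [coeFn_restr hA (restr B hB f), coeFn_restr hB f, coeFn_restr (hA.inter hB) f]
    with t h1 h2 h3
  rw [h1, h3, ← indicator_indicator, indicator, indicator]
  simp only [h2]

theorem inner_restr_left (f g : L2Line ℝ) :
    inner ℝ (restr A hA f) g = inner ℝ f (restr A hA g) := by
  rw [L2.inner_def, L2.inner_def]
  refine integral_congr_ae ?_
  filter_upwards [coeFn_restr hA f, coeFn_restr hA g] with t h1 h2
  rw [h1, h2]
  by_cases h : t ∈ A <;> simp [h]

theorem norm_restr_sq (f : L2Line ℝ) : ‖restr A hA f‖ ^ 2 = ∫ t in A, f t * f t := by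
  rw [← real_inner_self_eq_norm_sq, inner_restr_left, restr_restr, ← L2Line.integral_mul,
    ← integral_indicator hA]
  refine integral_congr_ae ?_
  filter_upwards [coeFn_restr (hA.inter hA) f] with t ht
  rw [ht, inter_self]
  by_cases h : t ∈ A <;> simp [h]

theorem restr_eq_self_iff {f : L2Line ℝ} : restr A hA f = f ↔ ∀ᵐ t, t ∉ A → f t = 0 := by
  constructor
  · intro h
    filter_upwards [coeFn_restr hA f] with t ht hn
    rw [h] at ht
    rw [ht, indicator_of_notMem hn]
  · intro h
    refine Lp.ext ?_
    filter_upwards [coeFn_restr hA f, h] with t ht h1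
    rw [ht]
    by_cases hn : t ∈ A
    · simp [hn]
    · simp [hn, h1]

theorem restr_eq_zero_iff {f : L2Line ℝ} : restr A hA f = 0 ↔ ∀ᵐ t, t ∈ A → f t = 0 := by
  constructor
  · intro h
    filter_upwards [coeFn_restr hA f, Lp.coeFn_zero ℝ 2 (volume : Measure ℝ)] with t ht h0 hn
    rw [h, h0, indicator_of_mem hn] at ht
    exact ht.symm
  · intro h
    refine Lp.ext ?_
    filter_upwards [coeFn_restr hA f, h, Lp.coeFn_zero ℝ 2 (volume : Measure ℝ)] with t ht h1 h0
    rw [ht, h0]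
    by_cases hn : t ∈ A
    · simp [hn, h1]
    · simp [hn]

theorem tendsto_restr_Ioi (τ : ℝ) (f : L2Line ℝ) :
    Tendsto (fun n : ℕ => restr (Ioi (τ + n)) measurableSet_Ioi f) atTop (𝓝 0) := by
  rw [tendsto_zero_iff_norm_tendsto_zero]
  have h : Tendsto (fun n : ℕ => ∫ t in Ioi (τ + n), f t * f t) atTop
      (𝓝 (∫ t in ⋂ n : ℕ, Ioi (τ + (n : ℝ)), f t * f t)) := by
    refine tendsto_setIntegral_of_antitone (fun _ => measurableSet_Ioi) (fun m n hmn => ?_)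
      ⟨0, (L2Line.integrable_mul f f).integrableOn⟩
    exact Ioi_subset_Ioi (by gcongr)
  have he : (⋂ n : ℕ, Ioi (τ + (n : ℝ))) = ∅ := by
    refine eq_empty_of_forall_notMem fun t ht => ?_
    obtain ⟨n, hn⟩ := exists_nat_gt (t - τ)
    have := mem_iInter.1 ht n
    rw [mem_Ioi] at this
    linarith
  rw [he, setIntegral_empty] at h
  have h2 := h.sqrt
  rw [Real.sqrt_zero] at h2
  refine h2.congr fun n => ?_
  rw [← norm_restr_sq measurableSet_Ioi, Real.sqrt_sq (norm_nonneg _)]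

end Restr

theorem exists_eq_apply_add {E : Type*} [NormedAddCommGroup E] [NormedSpace ℝ E] [CompleteSpace E]
    {A : E →L[ℝ] E} (hA : ‖A‖ < 1) (b : E) : ∃ z, z = A z + b := by
  obtain ⟨u, hu⟩ := isUnit_one_sub_of_norm_lt_one hA
  refine ⟨(↑u⁻¹ : E →L[ℝ] E) b, ?_⟩
  have h : (1 - A) ((↑u⁻¹ : E →L[ℝ] E) b) = b := by
    rw [← hu, ← mul_apply_eq_comp, Units.mul_inv, one_apply_eq_self]
  rw [sub_apply, one_apply_eq_self, sub_eq_iff_eq_add] at h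
  rw [add_comm]; exact h

/-! ### Continuation of truncated signals beyond the truncation time -/

namespace AltshullerMultiplier

variable {T : ℝ} (M : AltshullerMultiplier T)

theorem op_apply (f : L2Line ℝ) : M.op f = f - M.delayOp f := by
  rw [op, sub_apply, one_apply_eq_self]

theorem norm_restr_comp_lt_one {A : Set ℝ} (hA : MeasurableSet A) {K : L2Line ℝ →L[ℝ] L2Line ℝ}
    (hK : ‖K‖ < 1) : ‖(restr A hA).comp K‖ < 1 := by
  refine (ContinuousLinearMap.opNorm_comp_le _ _).trans_lt ?_
  nlinarith [norm_restr_le hA, norm_nonneg K, norm_nonneg (restr A hA)]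

/-- A signal can be continued on `A` so that the multiplier annihilates it there. -/
theorem exists_extension {A : Set ℝ} (hA : MeasurableSet A) (E : L2Line ℝ) :
    ∃ w, w = restr A hA (M.delayOp (E + w)) := by
  obtain ⟨w, hw⟩ := exists_eq_apply_add (norm_restr_comp_lt_one hA M.norm_delayOp_lt_one)
    (restr A hA (M.delayOp E))
  refine ⟨w, ?_⟩
  conv_lhs => rw [hw]
  rw [map_add, map_add, add_comm]; rfl

/-- A signal on the complement of `A` can be continued on `A` so that the adjoint of the multiplier
annihilates it there. -/
theorem exists_adj_extension {A : Set ℝ} (hA : MeasurableSet A) (D : L2Line ℝ)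
    (hD : restr A hA D = 0) :
    ∃ z, restr A hA z = z ∧ restr A hA (M.adj (D + z)) = 0 := by
  have hn : ‖ContinuousLinearMap.adjoint M.delayOp‖ < 1 := by
    rw [LinearIsometryEquiv.norm_map]; exact M.norm_delayOp_lt_one
  have hadj : ∀ f, M.adj f = f - ContinuousLinearMap.adjoint M.delayOp f := fun f => by
    refine ext_inner_right ℝ fun g => ?_
    rw [inner_adj_left, op_apply, inner_sub_right, inner_sub_left,
      ContinuousLinearMap.adjoint_inner_left]
  obtain ⟨z, hz⟩ := exists_eq_apply_add (norm_restr_comp_lt_one hA hn)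
    (restr A hA (ContinuousLinearMap.adjoint M.delayOp D))
  have hz' : z = restr A hA (ContinuousLinearMap.adjoint M.delayOp (D + z)) := by
    conv_lhs => rw [hz]
    rw [map_add, map_add, add_comm]; rfl
  have hzz : restr A hA z = z := by
    conv_lhs => rw [hz']
    rw [restr_restr]
    conv_rhs => rw [hz']
    congr! 2
    exact inter_self A
  refine ⟨z, hzz, ?_⟩
  rw [hadj, map_sub, map_add, hD, hzz, zero_add, ← hz', sub_self]

/-- Subtracting the two fixed-point equations, `v n - w` is a contraction of itself minus the tail
of a fixed `L²` signal beyond `τ + n`. Hence its norm is at most that of the tail divided by `1 -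
q`. -/
theorem tendsto_extension {τ : ℝ} {E w : L2Line ℝ} {v : ℕ → L2Line ℝ}
    (hw : w = restr (Ioi τ) measurableSet_Ioi (M.delayOp (E + w)))
    (hv : ∀ n : ℕ, v n = restr (Ioc τ (τ + n)) measurableSet_Ioc (M.delayOp (E + v n))) :
    Tendsto v atTop (𝓝 w) := by
  set q := ‖M.delayOp‖ with hq
  have hq1 : q < 1 := M.norm_delayOp_lt_one
  have hsplit : ∀ (n : ℕ) (f : L2Line ℝ), restr (Ioi τ) measurableSet_Ioi f =
      restr (Ioc τ (τ + n)) measurableSet_Ioc f + restr (Ioi (τ + n)) measurableSet_Ioi f := by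
    intro n f
    refine Lp.ext ?_
    filter_upwards [coeFn_restr (A := Ioi τ) measurableSet_Ioi f,
      coeFn_restr (A := Ioc τ (τ + n)) measurableSet_Ioc f,
      coeFn_restr (A := Ioi (τ + n)) measurableSet_Ioi f,
      Lp.coeFn_add (restr (Ioc τ (τ + n)) measurableSet_Ioc f)
        (restr (Ioi (τ + n)) measurableSet_Ioi f)] with t h1 h2 h3 h4
    rw [h4, Pi.add_apply, h1, h2, h3]
    have hn : (0 : ℝ) ≤ n := n.cast_nonneg
    simp only [indicator, mem_Ioi, mem_Ioc]
    by_cases ha : τ < t <;> by_cases hb : τ + n < t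
    · simp [ha, hb, not_le.2 hb]
    · simp [ha, hb, not_lt.1 hb]
    · exact absurd (by linarith) ha
    · simp [ha, hb]
  have hbound : ∀ n : ℕ, ‖v n - w‖ ≤
      (1 - q)⁻¹ * ‖restr (Ioi (τ + n)) measurableSet_Ioi (M.delayOp (E + w))‖ := by
    intro n
    have h1 : v n - w = restr (Ioc τ (τ + n)) measurableSet_Ioc (M.delayOp (v n - w)) -
        restr (Ioi (τ + n)) measurableSet_Ioi (M.delayOp (E + w)) := by
      have e1 := hv n
      have e2 := hw
      rw [hsplit n] at e2
      have e3 : v n - w = (E + v n) - (E + w) := by abel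
      have e4 : restr (Ioc τ (τ + n)) measurableSet_Ioc (M.delayOp (v n - w)) =
          v n - restr (Ioc τ (τ + n)) measurableSet_Ioc (M.delayOp (E + w)) := by
        rw [e3, map_sub, map_sub, ← e1]
      rw [e4, eq_sub_of_add_eq e2.symm]
      abel
    have h2 : ‖v n - w‖ ≤ q * ‖v n - w‖ +
        ‖restr (Ioi (τ + n)) measurableSet_Ioi (M.delayOp (E + w))‖ := by
      conv_lhs => rw [h1]
      refine (norm_sub_le _ _).trans (add_le_add_left ?_ _)
      calc _ ≤ ‖restr (Ioc τ (τ + n)) measurableSet_Ioc‖ * ‖M.delayOp (v n - w)‖ :=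
            ContinuousLinearMap.le_opNorm _ _
        _ ≤ 1 * (q * ‖v n - w‖) := by
            gcongr
            · exact norm_restr_le _
            · exact ContinuousLinearMap.le_opNorm _ _
        _ = _ := one_mul _
    rw [inv_mul_eq_div, le_div_iff₀ (by linarith)]
    linarith
  rw [tendsto_iff_norm_sub_tendsto_zero]
  refine squeeze_zero (fun n => norm_nonneg _) hbound ?_
  have := ((tendsto_restr_Ioi τ (M.delayOp (E + w))).norm).const_mul (1 - q)⁻¹
  simpa using this

/-- Positivity on finite sections implies positivity of the multiplier on truncated signals. -/
theorem inner_adj_nonneg_of_finite_sections {τ : ℝ} {D E z : L2Line ℝ}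
    (hz : restr (Ioi τ) measurableSet_Ioi z = z)
    (hE : restr (Ioi τ) measurableSet_Ioi E = 0)
    (hadj : restr (Ioi τ) measurableSet_Ioi (M.adj (D + z)) = 0)
    (hpos : ∀ (n : ℕ) (w : L2Line ℝ),
      w = restr (Ioc τ (τ + n)) measurableSet_Ioc (M.delayOp (E + w)) →
        0 ≤ inner ℝ D (M.op (E + w))) :
    0 ≤ inner ℝ (M.adj (D + z)) E := by
  obtain ⟨w, hw⟩ := M.exists_extension (A := Ioi τ) measurableSet_Ioi E
  choose v hv using fun n : ℕ => M.exists_extension (A := Ioc τ (τ + n)) measurableSet_Ioc E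
  have hlim : Tendsto (fun n => inner ℝ D (M.op (E + v n))) atTop
      (𝓝 (inner ℝ D (M.op (E + w)))) := by
    have h1 : Continuous fun x : L2Line ℝ => inner ℝ D (M.op (E + x)) :=
      continuous_const.inner (M.op.continuous.comp (continuous_const.add continuous_id))
    exact (h1.tendsto w).comp (M.tendsto_extension hw hv)
  have h0 : 0 ≤ inner ℝ D (M.op (E + w)) :=
    ge_of_tendsto' hlim fun n => hpos n _ (hv n)
  have hww : restr (Ioi τ) measurableSet_Ioi w = w := by
    conv_lhs => rw [hw]
    rw [restr_restr]
    conv_rhs => rw [hw]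
    congr! 2
    exact inter_self _
  have h1 : restr (Ioi τ) measurableSet_Ioi (M.op (E + w)) = 0 := by
    rw [op_apply, map_sub, ← hw, map_add, hE, hww, zero_add, sub_self]
  -- The two continuations decouple: `w` lives where `M*(D + z)` vanishes, and `z` lives where `M(E
  -- + w)` vanishes. Hence `⟨M*(D + z), E⟩ = ⟨D, M(E + w)⟩`.
  have h2 : inner ℝ (M.adj (D + z)) w = 0 := by
    rw [← hww, ← inner_restr_left, hadj, inner_zero_left]
  have h3 : inner ℝ z (M.op (E + w)) = 0 := by
    rw [← hz, inner_restr_left, h1, inner_zero_right]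
  have h4 : inner ℝ (M.adj (D + z)) (E + w) = inner ℝ (D + z) (M.op (E + w)) :=
    M.inner_adj_left _ _
  rw [inner_add_right, h2, add_zero, inner_add_left, h3, add_zero] at h4
  rw [h4]; exact h0

end AltshullerMultiplier

/-- The truncated gain bound: positivity of the multiplier on the nonlinear element and its
frequency-domain positivity on the linear element bound the truncated output. -/
theorem norm_le_of_positivity (G : StableLTI) {T : ℝ} (M : AltshullerMultiplier T) {κ h τ : ℝ}
    (h_pos : 0 < h)
    (hh : ∀ ω, 1 + ‖M.freq ω‖ ^ 2 ≤ 2 * h * (M.freq ω * (κ + G.freq ω)).re)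
    {D E R : L2Line ℝ}
    (hD : restr (Icc 0 τ) measurableSet_Icc D = D)
    (hE : restr (Icc 0 τ) measurableSet_Icc E = E)
    (hR : restr (Icc 0 τ) measurableSet_Icc R = R)
    (hlin : ∀ᵐ t, t ∈ Icc 0 τ → E t = R t - κ * D t - G.apply D t)
    (hpos : ∀ z, restr (Ioi τ) measurableSet_Ioi z = z →
      restr (Ioi τ) measurableSet_Ioi (M.adj (D + z)) = 0 → 0 ≤ inner ℝ (M.adj (D + z)) E)
    (hτ : 0 ≤ τ) : ‖D‖ ≤ h * ‖R‖ := by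
  rw [restr_eq_self_iff] at hE hR
  have hD' := (restr_eq_self_iff _).1 hD
  have hD0 : restr (Ioi τ) measurableSet_Ioi D = 0 :=
    (restr_eq_zero_iff _).2 (hD'.mono fun t ht h1 => ht fun h2 => absurd h2.2 (not_le.2 h1))
  -- With `M* f = 0` after `τ`, the values of `G f` there, which no loop equation controls, drop out
  -- of the quadratic form.
  obtain ⟨z, hz, hadj⟩ := M.exists_adj_extension measurableSet_Ioi D hD0
  have hp := hpos z hz hadj
  set f := D + z with hf
  have hq := quadratic_form_bound G M hh f
  have hz' := (restr_eq_self_iff _).1 hz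
  have hadj' := (restr_eq_zero_iff _).1 hadj
  have hfae : ∀ᵐ t, f t = D t + z t := Lp.coeFn_add D z
  have hf0 : ∀ᵐ t, t < 0 → f t = 0 := by
    filter_upwards [hfae, hD', hz'] with t h1 h2 h3 ht
    rw [h1, h2 (fun h => absurd h.1 (not_le.2 ht)),
      h3 (fun h => absurd (mem_Ioi.1 h) (not_lt.2 (ht.le.trans hτ))), add_zero]
  -- Causality is a pointwise statement, so it needs representatives that vanish everywhere, not
  -- just almost everywhere, outside their intervals.
  let φ : ℝ → ℝ := (Ici (0 : ℝ)).indicator f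
  have hφ : φ =ᵐ[volume] f := by
    filter_upwards [hf0] with t ht
    by_cases h : (0 : ℝ) ≤ t
    · simp [φ, h]
    · simp [φ, h, ht (not_le.1 h)]
  have hφL : MemLp φ 2 volume := (Lp.memLp f).indicator measurableSet_Ici
  let ψ : ℝ → ℝ := (Icc 0 τ).indicator φ
  have hψ : ψ =ᵐ[volume] D := by
    filter_upwards [hφ, hfae, hz', hD'] with t h1 h2 h3 h4
    by_cases h : t ∈ Icc 0 τ
    · simp only [ψ, indicator_of_mem h]
      rw [h1, h2, h3 (fun hc => absurd h.2 (not_le.2 hc)), add_zero]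
    · simp only [ψ, indicator_of_notMem h]
      rw [h4 h]
  have hψL : MemLp ψ 2 volume := hφL.indicator measurableSet_Icc
  have hGφ := G.apply_congr_ae hφL.unifLocL2 (Lp.memLp f).unifLocL2 hφ
  have hGψ := G.apply_congr_ae hψL.unifLocL2 (Lp.memLp D).unifLocL2 hψ
  have hneg : ∀ t < 0, G.apply φ t = 0 := fun t ht => by
    rw [← G.apply_zero t]
    refine G.apply_congr fun s hs => ?_
    simp [φ, not_le.2 (hs.trans_lt ht)]
  have hcaus : ∀ t ≤ τ, G.apply φ t = G.apply ψ t := fun t ht => by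
    refine G.apply_congr fun s hs => ?_
    by_cases h : (0 : ℝ) ≤ s
    · simp [ψ, h, hs.trans ht]
    · simp [ψ, φ, h]
  -- After `τ` the factor `M* f` vanishes, before `0` all signals multiplying it vanish, and on `[0,
  -- τ]` causality replaces `G f` by `G D`, given by the loop equation.
  have hmain : ∀ᵐ t, M.adj f t * G.apply f t =
      M.adj f t * R t - M.adj f t * E t - κ * (M.adj f t * f t) := by
    filter_upwards [hadj', hf0, hGφ, hGψ, hlin, hE, hR, hfae, hz'] with
      t h1 h2 h3 h4 h5 h6 h7 h8 h9
    by_cases ht : τ < t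
    · rw [h1 ht]; ring
    · rw [not_lt] at ht
      by_cases h0 : 0 ≤ t
      · rw [h5 ⟨h0, ht⟩, ← h3, hcaus t ht, h4, h8, h9 (fun hc => absurd ht (not_le.2 hc))]
        ring
      · rw [not_le] at h0
        rw [← h3, hneg t h0, h2 h0, h6 (fun hc => absurd hc.1 (not_le.2 h0)),
          h7 (fun hc => absurd hc.1 (not_le.2 h0))]
        ring
  have hint : ∫ t, M.adj f t * G.apply f t =
      inner ℝ (M.adj f) R - inner ℝ (M.adj f) E - κ * inner ℝ (M.adj f) f := by
    have i1 : Integrable fun t => M.adj f t * R t - M.adj f t * E t :=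
      (L2Line.integrable_mul _ _).sub (L2Line.integrable_mul _ _)
    rw [integral_congr_ae hmain, integral_sub i1 ((L2Line.integrable_mul _ _).const_mul _),
      integral_sub (L2Line.integrable_mul _ _) (L2Line.integrable_mul _ _), integral_const_mul,
      L2Line.integral_mul, L2Line.integral_mul, L2Line.integral_mul]
  rw [hint] at hq
  have hDz : inner ℝ D z = (0 : ℝ) := by
    rw [← hz, ← inner_restr_left, hD0, inner_zero_left]
  have hnorm : ‖D‖ ^ 2 ≤ ‖f‖ ^ 2 := by
    rw [hf, norm_add_sq_real, hDz]; nlinarith [norm_nonneg z]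
  have hcs := real_inner_le_norm (M.adj f) R
  have hfin : ‖D‖ ^ 2 ≤ (h * ‖R‖) ^ 2 := by
    have h1 : ‖f‖ ^ 2 + ‖M.adj f‖ ^ 2 ≤ 2 * h * (‖M.adj f‖ * ‖R‖) := by
      refine hq.trans (mul_le_mul_of_nonneg_left ?_ (by positivity))
      linarith
    -- Completing the square: `‖f‖² ≤ h²‖R‖² - (‖M* f‖ - h‖R‖)²`, and `‖D‖ ≤ ‖f‖` since `D` and `z`
    -- are orthogonal.
    nlinarith [sq_nonneg (‖M.adj f‖ - h * ‖R‖)]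
  exact (sq_le_sq₀ (norm_nonneg _) (by positivity)).1 hfin

/-! ## Positivity of the multiplier on periodically modulated monotone nonlinearities -/

/-- The primitive of a monotone function is convex, with `Q x` as a subgradient at `x`; continuity
of `Q` is not needed. -/
theorem Monotone.integral_sub_le_mul {Q : ℝ → ℝ} (hQ : Monotone Q) (x y : ℝ) :
    (∫ s in (0 : ℝ)..x, Q s) - (∫ s in (0 : ℝ)..y, Q s) ≤ Q x * (x - y) := by
  have hi : ∀ a b : ℝ, IntervalIntegrable Q volume a b := fun a b => hQ.intervalIntegrable
  rw [intervalIntegral.integral_interval_sub_left (hi _ _) (hi _ _)]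
  rcases le_total y x with h | h
  · have := intervalIntegral.integral_mono_on (μ := volume) h (hi y x)
      (intervalIntegrable_const (c := Q x)) fun s hs => hQ hs.2
    rw [intervalIntegral.integral_const, smul_eq_mul] at this
    linarith
  · have := intervalIntegral.integral_mono_on (μ := volume) h
      (intervalIntegrable_const (c := Q x)) (hi x y) fun s hs => hQ hs.1
    rw [intervalIntegral.integral_const, smul_eq_mul] at this
    rw [intervalIntegral.integral_symm]
    linarith

theorem Monotone.sub_mul_nonneg {Q : ℝ → ℝ} (hQ : Monotone Q) (u a : ℝ) :
    0 ≤ (Q (u + a) - Q u) * a := by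
  rcases le_total 0 a with h | h
  · exact mul_nonneg (sub_nonneg.2 (hQ (by linarith))) h
  · exact mul_nonneg_of_nonpos_of_nonpos (sub_nonpos.2 (hQ (by linarith))) h

/-- Cross-correlation inequality for a monotone nonlinearity around a signal with period `s`. -/
theorem inner_translateL2_le_inner {Q : ℝ → ℝ} (hQ : Monotone Q) {u : ℝ → ℝ}
    (hu : AEStronglyMeasurable u volume) {s : ℝ} (hus : ∀ t, u (t - s) = u t)
    {N e : L2Line ℝ} (hN : ∀ᵐ t, N t = Q (u t + e t) - Q (u t)) :
    inner ℝ N (translateL2 ℝ s e) ≤ inner ℝ N e := by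
  let V : ℝ → ℝ := fun x => ∫ r in (0 : ℝ)..x, Q r
  have hV : Continuous V := intervalIntegral.continuous_primitive
    (fun a b => hQ.intervalIntegrable) 0
  -- The excess of the convex primitive over its support line at `u t`. It lies between `0` and `N
  -- e`, hence is integrable.
  let W : ℝ → ℝ := fun t => V (u t + e t) - V (u t) - Q (u t) * e t
  have hem := Lp.aestronglyMeasurable e
  have hWm : AEStronglyMeasurable W volume := by
    refine ((hV.comp_aestronglyMeasurable (hu.add hem)).sub
      (hV.comp_aestronglyMeasurable hu)).sub (AEStronglyMeasurable.mul ?_ hem)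
    exact (hQ.measurable.comp_aemeasurable hu.aemeasurable).aestronglyMeasurable
  have hW0 : ∀ t, 0 ≤ W t := fun t => by
    have := hQ.integral_sub_le_mul (u t) (u t + e t)
    simp only [W, V]
    nlinarith
  have hWle : ∀ᵐ t, W t ≤ N t * e t := by
    filter_upwards [hN] with t ht
    have := hQ.integral_sub_le_mul (u t + e t) (u t)
    simp only [W, V]
    rw [ht]
    nlinarith
  have hWi : Integrable W := by
    refine (L2Line.integrable_mul N e).mono' hWm ?_
    filter_upwards [hWle] with t ht
    rwa [Real.norm_of_nonneg (hW0 t)]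
  have hWs : Integrable fun t => W (t - s) := hWi.comp_sub_right s
  -- Since `u` has period `s`, both values of `W` are based at the same point `u t`, and convexity
  -- compares them. Integrating, the left side cancels by translation invariance.
  have hpt : ∀ᵐ t, W t - W (t - s) ≤ N t * e t - N t * translateL2 ℝ s e t := by
    filter_upwards [hN, coeFn_translateL2 s e] with t h1 h2
    have := hQ.integral_sub_le_mul (u t + e t) (u t + e (t - s))
    simp only [W, V, hus]
    rw [h1, h2]
    nlinarith
  have hI := integral_mono_ae (hWi.sub hWs)
    ((L2Line.integrable_mul N e).sub (L2Line.integrable_mul N (translateL2 ℝ s e))) hpt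
  simp only [Pi.sub_apply] at hI
  rw [integral_sub hWi hWs, integral_sub_right_eq_self W s, sub_self,
    integral_sub (L2Line.integrable_mul N e) (L2Line.integrable_mul N _), L2Line.integral_mul,
    L2Line.integral_mul] at hI
  linarith

/-- Each shifted correlation is at most the unshifted one, which is nonnegative, and the weights sum
to less than one. -/
theorem AltshullerMultiplier.inner_op_nonneg {T : ℝ} (M : AltshullerMultiplier T) {Q : ℝ → ℝ}
    (hQ : Monotone Q) {u : ℝ → ℝ} (hu : AEStronglyMeasurable u volume)
    (hper : Function.Periodic u T) {N e : L2Line ℝ}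
    (hN : ∀ᵐ t, N t = Q (u t + e t) - Q (u t)) : 0 ≤ inner ℝ N (M.op e) := by
  have h0 : 0 ≤ inner ℝ N e := by
    rw [← L2Line.integral_mul]
    refine integral_nonneg_of_ae ?_
    filter_upwards [hN] with t ht
    rw [ht]; exact hQ.sub_mul_nonneg _ _
  have h1 : inner ℝ N (M.delayOp e) ≤ (∑' n, M.h n) * inner ℝ N e := by
    refine hasSum_le (fun n => ?_) (M.hasSum_inner_delayOp N e)
      (M.summable_h.hasSum.mul_right (inner ℝ N e))
    exact mul_le_mul_of_nonneg_left (inner_translateL2_le_inner hQ hu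
      (fun t => hper.sub_int_mul_eq n) hN) (M.h_nonneg n)
  rw [M.op_apply, inner_sub_right]
  nlinarith [M.sum_lt_one]

/-- Positivity on finite sections, for signals related by the nonlinearity on `[0, τ]`. -/
theorem AltshullerMultiplier.inner_op_section_nonneg {T : ℝ} (M : AltshullerMultiplier T)
    {Q : ℝ → ℝ} (hQ : Monotone Q) {C : ℝ} (hC : ∀ x, |Q x| ≤ C * |x|) {u : ℝ → ℝ}
    (hper : Function.Periodic u T)
    (hu : ∀ a b : ℝ, MemLp u 2 (volume.restrict (Icc a b)))
    (hum : AEStronglyMeasurable u volume) {τ : ℝ} (hτ : 0 ≤ τ) {D E : L2Line ℝ}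
    (hD : restr (Icc 0 τ) measurableSet_Icc D = D)
    (hE : restr (Icc 0 τ) measurableSet_Icc E = E)
    (hDE : ∀ᵐ t, t ∈ Icc 0 τ → D t = Q (u t + E t) - Q (u t))
    (n : ℕ) (w : L2Line ℝ)
    (hw : w = restr (Ioc τ (τ + n)) measurableSet_Ioc (M.delayOp (E + w))) :
    0 ≤ inner ℝ D (M.op (E + w)) := by
  set e := E + w with he
  have hea : ∀ᵐ t, e t = E t + w t := Lp.coeFn_add E w
  have hww : restr (Ioc τ (τ + n)) measurableSet_Ioc w = w := by
    conv_lhs => rw [hw]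
    rw [restr_restr]
    conv_rhs => rw [hw]
    congr! 2
    exact inter_self _
  rw [restr_eq_self_iff] at hD hE
  have hw' := (restr_eq_self_iff _).1 hww
  have hC0 : 0 ≤ C := by
    have := (abs_nonneg _).trans (hC 1); simpa using this
  let N₀ : ℝ → ℝ := fun t => Q (u t + e t) - Q (u t)
  have hem := Lp.aestronglyMeasurable e
  have hN₀m : AEStronglyMeasurable N₀ volume :=
    ((hQ.measurable.comp_aemeasurable (hum.add hem).aemeasurable).sub
      (hQ.measurable.comp_aemeasurable hum.aemeasurable)).aestronglyMeasurable
  -- The bounded support is why finite sections are used: `u` is only locally square integrable and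
  -- `Q` only linearly bounded, so square integrability of `N₀` is obtained from a bounded interval.
  have hind : N₀ =ᵐ[volume] (Icc 0 (τ + n)).indicator N₀ := by
    filter_upwards [hea, hE, hw'] with t h1 h2 h3
    by_cases ht : t ∈ Icc 0 (τ + n)
    · rw [indicator_of_mem ht]
    · have h4 : e t = 0 := by
        have hn : (0 : ℝ) ≤ n := n.cast_nonneg
        rw [h1, h2 (fun h => ht ⟨h.1, by linarith [h.2]⟩)]
        by_cases h5 : t ∈ Ioc τ (τ + n)
        · exact absurd ⟨hτ.trans h5.1.le, h5.2⟩ ht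
        · rw [h3 h5, add_zero]
      rw [indicator_of_notMem ht]
      simp [N₀, h4]
  have hN₀ : MemLp N₀ 2 volume := by
    refine MemLp.ae_eq hind.symm ((memLp_indicator_iff_restrict measurableSet_Icc).2 ?_)
    have hb : MemLp (fun t => 2 * |u t| + |e t|) 2 (volume.restrict (Icc 0 (τ + n))) :=
      ((hu 0 (τ + n)).abs.const_mul 2).add ((Lp.memLp e).restrict _).abs
    refine hb.of_le_mul (c := C) hN₀m.restrict (Eventually.of_forall fun t => ?_)
    rw [Real.norm_eq_abs, Real.norm_of_nonneg (by positivity)]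
    calc |N₀ t| ≤ |Q (u t + e t)| + |Q (u t)| := abs_sub _ _
      _ ≤ C * |u t + e t| + C * |u t| := add_le_add (hC _) (hC _)
      _ ≤ C * (|u t| + |e t|) + C * |u t| := by gcongr; exact abs_add_le _ _
      _ = C * (2 * |u t| + |e t|) := by ring
  let N : L2Line ℝ := hN₀.toLp N₀
  have hN : ∀ᵐ t, N t = Q (u t + e t) - Q (u t) := hN₀.coeFn_toLp
  have hpos := M.inner_op_nonneg hQ hum hper hN
  have hsplit : N = D + restr (Ioc τ (τ + n)) measurableSet_Ioc N := by
    refine Lp.ext ?_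
    filter_upwards [hN, hea, hE, hw', hD, hDE, coeFn_restr (A := Ioc τ (τ + n)) measurableSet_Ioc N,
      Lp.coeFn_add D (restr (Ioc τ (τ + n)) measurableSet_Ioc N)] with t h1 h2 h3 h4 h5 h6 h7 h8
    rw [h8, Pi.add_apply, h7]
    by_cases ha : t ∈ Ioc τ (τ + n)
    · rw [indicator_of_mem ha, h5 (fun h => absurd h.2 (not_le.2 ha.1)), zero_add]
    · rw [indicator_of_notMem ha, add_zero, h1, h2, h4 ha, add_zero]
      by_cases hb : t ∈ Icc 0 τ
      · rw [h6 hb]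
      · rw [h5 hb, h3 hb, add_zero, sub_self]
  -- `N` differs from `D` only on `(τ, τ + n]`, exactly where `w` was chosen to make `M e` vanish,
  -- so `D` may replace `N` in the pairing.
  have h0 : restr (Ioc τ (τ + n)) measurableSet_Ioc (M.op e) = 0 := by
    have hE0 : restr (Ioc τ (τ + n)) measurableSet_Ioc E = 0 :=
      (restr_eq_zero_iff _).2 (hE.mono fun t ht h1 => ht fun h2 => absurd h2.2 (not_le.2 h1.1))
    rw [M.op_apply, map_sub, ← hw, he, map_add, hE0, hww, zero_add, sub_self]
  rw [hsplit, inner_add_left, inner_restr_left, h0, inner_zero_right, add_zero] at hpos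
  exact hpos

/-! ## The truncated gain bound of the loop -/

/-- Loop transformation: a monotone `Q` with `κ (Q y - Q x) ≤ y - x` for `x ≤ y` is, for
`0 ≤ l < 1`, the composition of a monotone function with `x ↦ x - l κ Q x`. -/
theorem exists_loop_transform {Q : ℝ → ℝ} (hQ : Monotone Q) {C : ℝ} (hC : ∀ x, |Q x| ≤ C * |x|)
    {κ : ℝ} (hκ : 0 ≤ κ) (hslope : ∀ x y, x ≤ y → κ * (Q y - Q x) ≤ y - x) {l : ℝ} (hl0 : 0 ≤ l)
    (hl1 : l < 1) :
    ∃ Q' : ℝ → ℝ, Monotone Q' ∧ (∃ C', ∀ x, |Q' x| ≤ C' * |x|) ∧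
      ∀ x, Q' (x - l * κ * Q x) = Q x := by
  let φ : ℝ → ℝ := fun x => x - l * κ * Q x
  have hφ : ∀ x y, x ≤ y → (1 - l) * (y - x) ≤ φ y - φ x := fun x y hxy => by
    have := mul_le_mul_of_nonneg_left (hslope x y hxy) hl0
    simp only [φ]
    nlinarith
  have hmono : StrictMono φ := fun x y hxy => by
    have := hφ x y hxy.le
    nlinarith [mul_pos (sub_pos.2 hl1) (sub_pos.2 hxy)]
  -- Stated for `κ Q` because `κ = 0` is allowed, when `Q` itself may jump. Continuity and growth of
  -- `φ` give its surjectivity.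
  have hlip : LipschitzWith 1 fun x => κ * Q x := by
    refine LipschitzWith.of_le_add_mul 1 fun x y => ?_
    rw [NNReal.coe_one, one_mul, Real.dist_eq]
    rcases le_total y x with h | h
    · have := hslope y x h
      rw [abs_of_nonneg (sub_nonneg.2 h)]; linarith
    · have := mul_le_mul_of_nonneg_left (hQ h) hκ
      linarith [abs_nonneg (x - y)]
  have hcont : Continuous φ := by
    have : φ = fun x => x - l * (κ * Q x) := by funext x; simp only [φ]; ring
    rw [this]
    exact continuous_id.sub (continuous_const.mul hlip.continuous)
  have hQ0 : Q 0 = 0 := by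
    have := hC 0
    rw [abs_zero, mul_zero] at this
    exact abs_nonpos_iff.1 this
  have hφ0 : φ 0 = 0 := by simp [φ, hQ0]
  have hl : 0 < 1 - l := sub_pos.2 hl1
  have hsurj : Function.Surjective φ := by
    refine hcont.surjective ?_ ?_
    · refine tendsto_atTop_mono' _ ?_ (tendsto_id.const_mul_atTop hl)
      filter_upwards [eventually_ge_atTop 0] with x hx
      have := hφ 0 x hx
      simpa [hφ0] using this
    · refine tendsto_atBot_mono' _ ?_ (tendsto_id.const_mul_atBot hl)
      filter_upwards [eventually_le_atBot 0] with x hx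
      have := hφ x 0 hx
      simp only [hφ0, id] at this ⊢
      linarith
  let ψ := Function.surjInv hsurj
  have hφψ : ∀ x, φ (ψ x) = x := Function.surjInv_eq hsurj
  have hψφ : ∀ x, ψ (φ x) = x := fun x => hmono.injective (hφψ _)
  have hψmono : Monotone ψ := fun x y hxy => by
    rw [← hmono.le_iff_le, hφψ, hφψ]; exact hxy
  have hC0 : 0 ≤ C := by
    have := (abs_nonneg _).trans (hC 1); simpa using this
  refine ⟨Q ∘ ψ, hQ.comp hψmono, ⟨C * (1 - l)⁻¹, fun x => ?_⟩, fun x => ?_⟩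
  · refine (hC _).trans ?_
    rw [mul_assoc]
    refine mul_le_mul_of_nonneg_left ?_ hC0
    rw [inv_mul_eq_div, le_div_iff₀ hl]
    have hx : φ (ψ x) = x := hφψ x
    rcases le_total 0 (ψ x) with h | h
    · have := hφ 0 _ h
      rw [hx, hφ0, sub_zero, sub_zero] at this
      rw [abs_of_nonneg h]
      linarith [le_abs_self x]
    · have := hφ _ 0 h
      rw [hx, hφ0] at this
      rw [abs_of_nonpos h]
      linarith [neg_abs_le x]
  · exact congrArg Q (hψφ x)

section Gain

variable (G : StableLTI) {T : ℝ} (M : AltshullerMultiplier T) {Q : ℝ → ℝ} (hQ : Monotone Q)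
  {C : ℝ} (hC : ∀ x, |Q x| ≤ C * |x|) {κ : ℝ} (hκ : 0 ≤ κ)
  (hslope : ∀ x y, x ≤ y → κ * (Q y - Q x) ≤ y - x) {h : ℝ} (h_pos : 0 < h)
  (hh : ∀ ω, 1 + ‖M.freq ω‖ ^ 2 ≤ 2 * h * (M.freq ω * (κ + G.freq ω)).re)
  {u : ℝ → ℝ} (hper : Function.Periodic u T)
  (hu : ∀ a b : ℝ, MemLp u 2 (volume.restrict (Icc a b))) (hum : AEStronglyMeasurable u volume)
  {τ : ℝ} (hτ : 0 ≤ τ)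
include hQ hC hκ hslope h_pos hh hper hu hum hτ

/-- Replacing `E` by `E - κ D` adds `κ` to the linear element. The nonlinear element stays monotone
for the factor `l κ` with `l < 1`; at `l = 1` the map `x ↦ x - κ Q x` may fail to be injective, so
that case is reached as a limit. -/
theorem norm_output_le {D E R : L2Line ℝ}
    (hD : restr (Icc 0 τ) measurableSet_Icc D = D)
    (hE : restr (Icc 0 τ) measurableSet_Icc E = E)
    (hR : restr (Icc 0 τ) measurableSet_Icc R = R)
    (hDE : ∀ᵐ t, t ∈ Icc 0 τ → D t = Q (u t + E t) - Q (u t))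
    (hlin : ∀ᵐ t, t ∈ Icc 0 τ → E t = R t - G.apply D t) : ‖D‖ ≤ h * ‖R‖ := by
  have hcomb : ∀ c : ℝ, restr (Icc 0 τ) measurableSet_Icc (E - c • D) = E - c • D := fun c => by
    rw [map_sub, map_smul, hD, hE]
  have hcombae : ∀ c : ℝ, ∀ᵐ t, (E - c • D : L2Line ℝ) t = E t - c * D t := fun c => by
    filter_upwards [Lp.coeFn_sub E (c • D), Lp.coeFn_smul c D] with t h1 h2
    rw [h1, Pi.sub_apply, h2, Pi.smul_apply, smul_eq_mul]
  refine norm_le_of_positivity G M (E := E - κ • D) h_pos hh hD (hcomb κ) hR ?_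
    (fun z hz hadj => ?_) hτ
  · filter_upwards [hlin, hcombae κ] with t h1 h2 ht
    rw [h2, h1 ht]; ring
  have hsec : ∀ l : ℝ, 0 ≤ l → l < 1 →
      0 ≤ inner ℝ (M.adj (D + z)) (E - (l * κ) • D) := by
    intro l hl0 hl1
    obtain ⟨Q', hQ', ⟨C', hC'⟩, hQQ⟩ := exists_loop_transform hQ hC hκ hslope hl0 hl1
    have hE0 : restr (Ioi τ) measurableSet_Ioi (E - (l * κ) • D) = 0 :=
      (restr_eq_zero_iff _).2 (((restr_eq_self_iff _).1 (hcomb (l * κ))).mono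
        fun t ht h1 => ht fun h2 => absurd h2.2 (not_le.2 h1))
    -- The reference signal undergoes the same transformation as the error; it stays `T`-periodic
    -- because `Q` does not depend on time.
    let u' : ℝ → ℝ := fun t => u t - l * κ * Q (u t)
    have hQu : AEStronglyMeasurable (fun t => Q (u t)) volume :=
      (hQ.measurable.comp_aemeasurable hum.aemeasurable).aestronglyMeasurable
    have hum' : AEStronglyMeasurable u' volume := hum.sub (hQu.const_mul _)
    have hu' : ∀ a b : ℝ, MemLp u' 2 (volume.restrict (Icc a b)) := fun a b => by
      refine (hu a b).sub (MemLp.const_mul ?_ _)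
      exact (hu a b).of_le_mul (c := C) hQu.restrict (Eventually.of_forall fun t => hC _)
    have hper' : Function.Periodic u' T := fun t => by simp only [u', hper t]
    refine M.inner_adj_nonneg_of_finite_sections hz hE0 hadj fun n w hw => ?_
    refine M.inner_op_section_nonneg hQ' hC' hper' hu' hum' hτ hD (hcomb _) ?_ n w hw
    filter_upwards [hDE, hcombae (l * κ)] with t h1 h2 ht
    have h3 := hQQ (u t + E t)
    have h4 := hQQ (u t)
    have h5 : u' t + (E - (l * κ) • D : L2Line ℝ) t =
        u t + E t - l * κ * Q (u t + E t) := by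
      rw [h2, h1 ht]; simp only [u']; ring
    rw [h5, h3, h4, h1 ht]
  have hlim : Tendsto (fun l : ℝ => inner ℝ (M.adj (D + z)) (E - (l * κ) • D)) (𝓝[<] 1)
      (𝓝 (inner ℝ (M.adj (D + z)) (E - κ • D))) := by
    have hc : Continuous fun l : ℝ => inner ℝ (M.adj (D + z)) (E - (l * κ) • D) :=
      continuous_const.inner (continuous_const.sub
        ((continuous_id.mul continuous_const).smul continuous_const))
    have := (hc.tendsto 1).mono_left (nhdsWithin_le_nhds (s := Iio 1))
    rwa [one_mul] at this
  refine ge_of_tendsto hlim ?_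
  filter_upwards [self_mem_nhdsWithin, mem_nhdsWithin_of_mem_nhds (Ioi_mem_nhds zero_lt_one)]
    with l h1 h0
  exact hsec l (le_of_lt h0) h1

theorem eLpNorm_output_le {d e ρ : ℝ → ℝ}
    (hd : MemLp d 2 (volume.restrict (Icc 0 τ))) (he : MemLp e 2 (volume.restrict (Icc 0 τ)))
    (hρ : MemLp ρ 2 (volume.restrict (Icc 0 τ)))
    (hde : ∀ᵐ t, t ∈ Icc 0 τ → d t = Q (u t + e t) - Q (u t))
    (hlin : ∀ᵐ t, t ∈ Icc 0 τ → e t = ρ t - G.apply ((Icc 0 τ).indicator d) t) :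
    eLpNorm d 2 (volume.restrict (Icc 0 τ)) ≤
      ENNReal.ofReal h * eLpNorm ρ 2 (volume.restrict (Icc 0 τ)) := by
  have mk : ∀ {f : ℝ → ℝ}, MemLp f 2 (volume.restrict (Icc 0 τ)) →
      MemLp ((Icc 0 τ).indicator f) 2 volume := fun hf =>
    (memLp_indicator_iff_restrict measurableSet_Icc).2 hf
  have hsupp : ∀ {f : ℝ → ℝ} (hf : MemLp f 2 (volume.restrict (Icc 0 τ))),
      restr (Icc 0 τ) measurableSet_Icc ((mk hf).toLp _) = (mk hf).toLp _ := fun hf => by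
    rw [restr_eq_self_iff]
    filter_upwards [(mk hf).coeFn_toLp] with t ht hn
    rw [ht, indicator_of_notMem hn]
  have hG := G.apply_congr_ae (Lp.memLp ((mk hd).toLp _)).unifLocL2 (mk hd).unifLocL2
    (mk hd).coeFn_toLp
  have hb := norm_output_le G M hQ hC hκ hslope h_pos hh hper hu hum hτ (hsupp hd) (hsupp he)
    (hsupp hρ) (by
      filter_upwards [(mk hd).coeFn_toLp, (mk he).coeFn_toLp, hde] with t h1 h2 h3 ht
      rw [h1, h2, indicator_of_mem ht, indicator_of_mem ht, h3 ht]) (by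
      filter_upwards [(mk he).coeFn_toLp, (mk hρ).coeFn_toLp, hlin, hG] with t h2 h3 h4 h5 ht
      rw [h2, h3, indicator_of_mem ht, indicator_of_mem ht, h4 ht, h5])
  rw [Lp.norm_toLp, Lp.norm_toLp, eLpNorm_indicator_eq_eLpNorm_restrict measurableSet_Icc,
    eLpNorm_indicator_eq_eLpNorm_restrict measurableSet_Icc] at hb
  rw [← ENNReal.ofReal_toReal hd.2.ne, ← ENNReal.ofReal_toReal hρ.2.ne,
    ← ENNReal.ofReal_mul h_pos.le]
  exact ENNReal.ofReal_le_ofReal hb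

end Gain

/-! ## Energy and power of signals -/

/-- The root mean square of `y` on `[0, τ]`. -/
def rms (y : ℝ → ℝ) (τ : ℝ) : ℝ≥0∞ :=
  eLpNorm y 2 (volume.restrict (Icc 0 τ)) / ENNReal.ofReal τ ^ (1 / 2 : ℝ)

theorem rms_eq (y : ℝ → ℝ) (τ : ℝ) :
    rms y τ = ((∫⁻ t in Icc 0 τ, ‖y t‖ₑ ^ 2) / ENNReal.ofReal τ) ^ (1 / 2 : ℝ) := by
  rw [ENNReal.div_rpow_of_nonneg _ _ (by norm_num), lintegral_enorm_sq_eq, rms,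
    ← ENNReal.rpow_natCast, ← ENNReal.rpow_mul]
  norm_num

/-- The square root is an order isomorphism of `[0, ∞]`, hence commutes with the upper limit. -/
theorem powerSeminorm_eq_limsup_rms (y : ℝ → ℝ) : powerSeminorm y = limsup (rms y) atTop := by
  have h := (ENNReal.orderIsoRpow (1 / 2 : ℝ) (by norm_num)).limsup_apply (f := atTop)
    (u := fun τ : ℝ => (∫⁻ t in Icc 0 τ, ‖y t‖ₑ ^ 2) / ENNReal.ofReal τ)
  simp only [ENNReal.orderIsoRpow_apply, ← rms_eq] at h
  exact h

/-- The signal has zero power, as a limit. -/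
def ZeroPower (y : ℝ → ℝ) : Prop := Tendsto (rms y) atTop (𝓝 0)

theorem ZeroPower.powerSeminorm_eq {y : ℝ → ℝ} (h : ZeroPower y) : powerSeminorm y = 0 := by
  rw [powerSeminorm_eq_limsup_rms]; exact h.limsup_eq

theorem rms_le_of_eLpNorm_le {a b c : ℝ → ℝ} {k k' : ℝ≥0∞} {τ : ℝ}
    (h : eLpNorm a 2 (volume.restrict (Icc 0 τ)) ≤
      k * eLpNorm b 2 (volume.restrict (Icc 0 τ)) + k' * eLpNorm c 2 (volume.restrict (Icc 0 τ))) :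
    rms a τ ≤ k * rms b τ + k' * rms c τ := by
  unfold rms
  rw [← mul_div_assoc, ← mul_div_assoc, ENNReal.div_add_div_same]
  exact ENNReal.div_le_div_right h _

theorem ZeroPower.of_le {a b c : ℝ → ℝ} {k k' : ℝ≥0∞} (hk : k ≠ ∞) (hk' : k' ≠ ∞)
    (h : ∀ τ : ℝ, 0 ≤ τ → eLpNorm a 2 (volume.restrict (Icc 0 τ)) ≤
      k * eLpNorm b 2 (volume.restrict (Icc 0 τ)) + k' * eLpNorm c 2 (volume.restrict (Icc 0 τ)))
    (hb : ZeroPower b) (hc : ZeroPower c) : ZeroPower a := by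
  have h1 : Tendsto (fun τ => k * rms b τ + k' * rms c τ) atTop (𝓝 0) := by
    have := (ENNReal.Tendsto.const_mul hb (Or.inr hk)).add
      (ENNReal.Tendsto.const_mul hc (Or.inr hk'))
    simpa using this
  refine tendsto_of_tendsto_of_tendsto_of_le_of_le' tendsto_const_nhds h1
    (Eventually.of_forall fun _ => zero_le) ?_
  filter_upwards [eventually_ge_atTop 0] with τ hτ
  exact rms_le_of_eLpNorm_le (h τ hτ)

theorem zeroPower_zero : ZeroPower 0 := by
  have : rms 0 = fun _ => 0 := by funext τ; simp [rms]
  rw [ZeroPower, this]; exact tendsto_const_nhds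

theorem powerSeminorm_le_of_le {a b c : ℝ → ℝ} {k : ℝ≥0∞} (hk : k ≠ ∞)
    (h : ∀ τ : ℝ, 0 ≤ τ → eLpNorm a 2 (volume.restrict (Icc 0 τ)) ≤
      k * eLpNorm b 2 (volume.restrict (Icc 0 τ)) + k * eLpNorm c 2 (volume.restrict (Icc 0 τ)))
    (hc : ZeroPower c) : powerSeminorm a ≤ k * powerSeminorm b := by
  have h1 : Tendsto (fun τ => k * rms c τ) atTop (𝓝 0) := by
    have := ENNReal.Tendsto.const_mul hc (Or.inr hk)
    simpa using this
  rw [powerSeminorm_eq_limsup_rms, powerSeminorm_eq_limsup_rms,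
    ← ENNReal.limsup_const_mul_of_ne_top hk]
  have h2 := ENNReal.limsup_add_of_right_tendsto_zero h1 (fun τ => k * rms b τ)
  refine le_trans (limsup_le_limsup ?_) h2.le
  filter_upwards [eventually_ge_atTop 0] with τ hτ
  exact rms_le_of_eLpNorm_le (h τ hτ)

theorem Ici_eq_iUnion_Icc : Ici (0 : ℝ) = ⋃ n : ℕ, Icc (0 : ℝ) n := by
  ext t
  simp only [mem_Ici, mem_iUnion, mem_Icc]
  exact ⟨fun h => ⟨⌈t⌉₊, h, Nat.le_ceil t⟩, fun ⟨_, h, _⟩ => h⟩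

theorem MemL2e.aestronglyMeasurable {y : ℝ → ℝ} (hy : MemL2e y) :
    AEStronglyMeasurable y (volume.restrict (Ici 0)) := by
  rw [Ici_eq_iUnion_Icc]
  exact AEStronglyMeasurable.iUnion fun n => (hy n).1

theorem eLpNorm_Ici_le {y : ℝ → ℝ} {B : ℝ≥0∞}
    (h : ∀ τ : ℝ, 0 ≤ τ → eLpNorm y 2 (volume.restrict (Icc 0 τ)) ≤ B) :
    eLpNorm y 2 (volume.restrict (Ici 0)) ≤ B := by
  have h1 : ∫⁻ t in Ici 0, ‖y t‖ₑ ^ 2 ≤ B ^ 2 := by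
    rw [Ici_eq_iUnion_Icc, setLIntegral_iUnion_of_directed]
    · refine iSup_le fun n => ?_
      rw [lintegral_enorm_sq_eq]
      exact pow_le_pow_left' (h n n.cast_nonneg) 2
    · refine Monotone.directed_le fun m n hmn => Icc_subset_Icc_right ?_
      exact_mod_cast hmn
  rw [lintegral_enorm_sq_eq] at h1
  exact (ENNReal.pow_le_pow_left_iff (two_ne_zero)).1 h1

theorem MemL2.energyVanishes {y : ℝ → ℝ} (hy : MemL2 y) : EnergyVanishes y := by
  have hy' : MemLp y 2 (volume.restrict (Ici 0)) := hy
  obtain ⟨v, hv, hyv⟩ := hy'.1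
  have h1 : Tendsto (fun τ : ℝ => ∫⁻ t in Ici 0, (Ici τ).indicator (fun t => ‖v t‖ₑ ^ 2) t) atTop
      (𝓝 (∫⁻ _ in Ici (0 : ℝ), 0)) := by
    refine tendsto_lintegral_filter_of_dominated_convergence (fun t => ‖v t‖ₑ ^ 2)
      (Eventually.of_forall fun τ => ?_) (Eventually.of_forall fun τ => ?_) ?_ ?_
    · exact (hv.measurable.enorm.pow_const 2).indicator measurableSet_Ici
    · exact Eventually.of_forall fun t => indicator_le_self _ _ _
    · exact (lintegral_enorm_sq_lt_top (hy'.ae_eq hyv)).ne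
    · refine Eventually.of_forall fun t => tendsto_const_nhds.congr' ?_
      filter_upwards [eventually_gt_atTop t] with τ hτ
      rw [indicator_of_notMem]
      exact not_le.2 hτ
  rw [lintegral_zero] at h1
  have h2 := h1.ennrpow_const (1 / 2)
  rw [ENNReal.zero_rpow_of_pos (by norm_num)] at h2
  refine h2.congr' ?_
  filter_upwards [eventually_ge_atTop 0] with τ hτ
  have hsub : Ici τ ⊆ Ici (0 : ℝ) := Ici_subset_Ici.2 hτ
  have hyv' : y =ᵐ[volume.restrict (Ici τ)] v := ae_restrict_of_ae_restrict_of_subset hsub hyv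
  rw [lintegral_indicator measurableSet_Ici, Measure.restrict_restrict measurableSet_Ici,
    inter_eq_left.2 hsub, eLpNorm_congr_ae hyv', lintegral_enorm_sq_eq, ← ENNReal.rpow_natCast,
    ← ENNReal.rpow_mul]
  norm_num

/-! ## Periodic signals -/

section Periodic

variable {T : ℝ} {y : ℝ → ℝ}

theorem PeriodicSignal.sub_nat_mul (hT : 0 < T) (hy : PeriodicSignal T y) (n : ℕ) :
    ∀ᵐ t : ℝ, n * T ≤ t → y t = y (t - n * T) := by
  have hy' : ∀ᵐ t : ℝ, 0 ≤ t → y (t + T) = y t := (ae_restrict_iff' measurableSet_Ici).1 hy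
  induction n with
  | zero => exact Eventually.of_forall fun t _ => by simp
  | succ n ih =>
    filter_upwards [ih, (measurePreserving_sub_right volume ((n + 1) * T)).quasiMeasurePreserving.ae
      hy'] with t h1 h2 ht
    push_cast at ht ⊢
    rw [h1 (by nlinarith), ← h2 (by linarith)]
    congr 1
    ring

theorem PeriodicSignal.sub {x : ℝ → ℝ} (hy : PeriodicSignal T y) (hx : PeriodicSignal T x) :
    PeriodicSignal T (y - x) := by
  unfold PeriodicSignal EqSignal at *
  filter_upwards [hy, hx] with t h1 h2
  simp only [Pi.sub_apply, h1, h2]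

theorem PeriodicSignal.lintegral_Ico (hT : 0 < T) (hy : PeriodicSignal T y) (n : ℕ) :
    ∫⁻ t in Ico 0 (n * T), ‖y t‖ₑ ^ 2 = n * ∫⁻ t in Ico 0 T, ‖y t‖ₑ ^ 2 := by
  induction n with
  | zero => simp
  | succ n ih =>
    have hnT : 0 ≤ n * T := by positivity
    have hu : Ico 0 ((n + 1 : ℕ) * T) = Ico 0 (n * T) ∪ Ico (n * T) ((n + 1 : ℕ) * T) :=
      (Ico_union_Ico_eq_Ico hnT (by push_cast; nlinarith)).symm
    rw [hu, lintegral_union measurableSet_Ico (Ico_disjoint_Ico_same), ih]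
    have h2 : ∫⁻ t in Ico (n * T) ((n + 1 : ℕ) * T), ‖y t‖ₑ ^ 2 =
        ∫⁻ t in Ico 0 T, ‖y t‖ₑ ^ 2 := by
      rw [← lintegral_indicator measurableSet_Ico, ← lintegral_indicator measurableSet_Ico,
        ← lintegral_sub_right_eq_self ((Ico 0 T).indicator fun t => ‖y t‖ₑ ^ 2) (n * T)]
      refine lintegral_congr_ae ?_
      filter_upwards [hy.sub_nat_mul hT n] with t ht
      by_cases h : t ∈ Ico (n * T) ((n + 1 : ℕ) * T)
      · have h' : t - n * T ∈ Ico 0 T := by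
          have h1 := h.1; have h2 := h.2
          push_cast at h2
          constructor <;> linarith
        rw [indicator_of_mem h, indicator_of_mem h', ht h.1]
      · have h' : t - n * T ∉ Ico 0 T := fun hc => h (by
          have h1 := hc.1; have h2 := hc.2
          constructor
          · linarith
          · push_cast; linarith)
        rw [indicator_of_notMem h, indicator_of_notMem h']
    rw [h2]; push_cast; ring

/-- A periodic signal without power vanishes. -/
theorem PeriodicSignal.eqSignal_zero (hT : 0 < T) (hy : PeriodicSignal T y) (hm : MemL2e y)
    (hz : ZeroPower y) : EqSignal y 0 := by
  set I := ∫⁻ t in Ico 0 T, ‖y t‖ₑ ^ 2 with hI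
  have hTtop : ENNReal.ofReal T ≠ ∞ := ENNReal.ofReal_ne_top
  have hT0 : ENNReal.ofReal T ≠ 0 := (ENNReal.ofReal_pos.2 hT).ne'
  -- At whole numbers of periods the root mean square is the constant `(I / T)^(1/2)`; `n + 1`
  -- avoids the empty interval.
  have hlim : Tendsto (fun n : ℕ => rms y ((n + 1 : ℕ) * T)) atTop (𝓝 0) := by
    refine hz.comp ?_
    exact ((tendsto_natCast_atTop_atTop.comp (tendsto_add_atTop_nat 1)).atTop_mul_const hT)
  have hconst : ∀ n : ℕ, rms y ((n + 1 : ℕ) * T) = (I / ENNReal.ofReal T) ^ (1 / 2 : ℝ) := fun n => by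
    rw [rms_eq, setLIntegral_congr Ico_ae_eq_Icc.symm, hy.lintegral_Ico hT,
      ENNReal.ofReal_mul (by positivity), ENNReal.ofReal_natCast]
    congr 1
    exact ENNReal.mul_div_mul_left _ _ (by simp) (ENNReal.natCast_ne_top _)
  simp only [hconst] at hlim
  have h0 : (I / ENNReal.ofReal T) ^ (1 / 2 : ℝ) = 0 := tendsto_nhds_unique tendsto_const_nhds hlim
  have hI0 : I = 0 := by
    rw [ENNReal.rpow_eq_zero_iff_of_pos (by norm_num), ENNReal.div_eq_zero_iff] at h0
    exact h0.resolve_right hTtop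
  have hall : ∀ n : ℕ, ∀ᵐ t ∂(volume.restrict (Ico 0 (n * T))), y t = 0 := fun n => by
    have h1 := hy.lintegral_Ico hT n
    rw [← hI, hI0, mul_zero] at h1
    have hmn : AEStronglyMeasurable y (volume.restrict (Ico 0 (n * T))) :=
      hm.aestronglyMeasurable.mono_measure (Measure.restrict_mono Ico_subset_Ici_self le_rfl)
    rw [lintegral_eq_zero_iff' (hmn.enorm.pow_const 2)] at h1
    filter_upwards [h1] with t ht
    simpa using ht
  have hall2 : ∀ᵐ t : ℝ, ∀ n : ℕ, t ∈ Ico 0 (n * T) → y t = 0 :=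
    ae_all_iff.2 fun n => (ae_restrict_iff' measurableSet_Ico).1 (hall n)
  refine (ae_restrict_iff' measurableSet_Ici).2 ?_
  filter_upwards [hall2] with t ht h0
  obtain ⟨n, hn⟩ := exists_nat_gt (t / T)
  exact ht n ⟨h0, (div_lt_iff₀ hT).1 hn⟩

/-- The periodic extension to the line of a signal that is periodic on `[0, ∞)`. -/
theorem PeriodicSignal.exists_periodic (hT : 0 < T) (hy : PeriodicSignal T y) (hm : MemL2e y) :
    ∃ u : ℝ → ℝ, Function.Periodic u T ∧
      (∀ a b : ℝ, MemLp u 2 (volume.restrict (Icc a b))) ∧ AEStronglyMeasurable u volume ∧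
      EqSignal u y := by
  let u : ℝ → ℝ := fun t => y (toIcoMod hT 0 t)
  have hper : Function.Periodic u T := fun t => by simp only [u, toIcoMod_add_right]
  have hall : ∀ᵐ t : ℝ, ∀ n : ℕ, n * T ≤ t → y t = y (t - n * T) :=
    ae_all_iff.2 fun n => hy.sub_nat_mul hT n
  have hae : ∀ᵐ t : ℝ, 0 ≤ t → u t = y t := by
    filter_upwards [hall] with t ht h0
    have hd := toIcoMod_mem_Ico hT 0 t
    have hself := self_sub_toIcoDiv_zsmul hT 0 t
    rw [zsmul_eq_mul] at hself
    have hk : 0 ≤ toIcoDiv hT 0 t := by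
      by_contra hc
      have h1 : (toIcoDiv hT 0 t : ℝ) ≤ -1 := by
        have : toIcoDiv hT 0 t ≤ -1 := by omega
        exact_mod_cast this
      have h2 := hd.2
      rw [← hself] at h2
      nlinarith
    obtain ⟨n, hn⟩ := Int.eq_ofNat_of_zero_le hk
    rw [hn, Int.cast_natCast] at hself
    have h3 := hd.1
    rw [← hself] at h3
    rw [ht n (by linarith)]
    simp only [u, ← hself]
  have hmem : ∀ a b : ℝ, MemLp u 2 (volume.restrict (Icc a b)) := fun a b => by
    -- Shifting by enough periods moves `[a, b]` into `[0, ∞)`, where `u` agrees with `y`.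
    obtain ⟨n, hn⟩ := exists_nat_gt (-a / T)
    have hn' : 0 ≤ a + n * T := by
      have := (div_lt_iff₀ hT).1 hn
      linarith
    have hshift : ∀ᵐ t : ℝ, 0 ≤ t + n * T → u t = y (t + n * T) := by
      filter_upwards [(measurePreserving_add_right volume (n * T)).quasiMeasurePreserving.ae hae]
        with t ht h0
      rw [← ht h0]
      exact (hper.nat_mul n t).symm
    have hy1 : MemLp ((Icc 0 (b + n * T)).indicator y) 2 volume :=
      (memLp_indicator_iff_restrict measurableSet_Icc).2 (hm _)
    have hy2 := (hy1.comp_measurePreserving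
      (measurePreserving_add_right volume (n * T))).restrict (Icc a b)
    refine hy2.ae_eq ((ae_restrict_iff' measurableSet_Icc).2 ?_)
    filter_upwards [hshift] with t ht hab
    have h0 : 0 ≤ t + n * T := by linarith [hab.1]
    rw [ht h0, Function.comp_apply, indicator_of_mem]
    exact ⟨h0, by linarith [hab.2]⟩
  refine ⟨u, hper, hmem, ?_, (ae_restrict_iff' measurableSet_Ici).2 hae⟩
  have hun : (⋃ n : ℕ, Icc (-(n : ℝ)) n) = univ := by
    refine eq_univ_of_forall fun t => mem_iUnion.2 ⟨⌈|t|⌉₊, ?_⟩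
    exact abs_le.1 (Nat.le_ceil |t|)
  have := AEStronglyMeasurable.iUnion (μ := volume) (f := u)
    (s := fun n : ℕ => Icc (-(n : ℝ)) n) fun n => (hmem _ _).1
  rwa [hun, Measure.restrict_univ] at this

end Periodic

/-! ## The free response -/

theorem UnifLocL2.sub {u v : ℝ → ℝ} (hu : UnifLocL2 u) (hv : UnifLocL2 v) : UnifLocL2 (u - v) := by
  obtain ⟨hum, C, hC, hub⟩ := hu
  obtain ⟨hvm, K, hK, hvb⟩ := hv
  refine ⟨hum.sub hvm, (C ^ (1 / 2 : ℝ) + K ^ (1 / 2 : ℝ)) ^ 2, ?_, fun a => ?_⟩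
  · exact ENNReal.pow_lt_top (ENNReal.add_lt_top.2
      ⟨ENNReal.rpow_lt_top_of_nonneg (by norm_num) hC.ne,
        ENNReal.rpow_lt_top_of_nonneg (by norm_num) hK.ne⟩)
  · have hsq : ∀ {w : ℝ → ℝ} {B : ℝ≥0∞}, ∫⁻ t in Icc a (a + 1), ‖w t‖ₑ ^ 2 ≤ B →
        eLpNorm w 2 (volume.restrict (Icc a (a + 1))) ≤ B ^ (1 / 2 : ℝ) := fun {w B} h => by
      rw [lintegral_enorm_sq_eq] at h
      have := ENNReal.rpow_le_rpow h (by norm_num : (0 : ℝ) ≤ 1 / 2)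
      rw [← ENNReal.rpow_natCast, ← ENNReal.rpow_mul] at this
      norm_num at this ⊢
      exact this
    rw [lintegral_enorm_sq_eq]
    refine pow_le_pow_left' ((eLpNorm_sub_le hum.restrict hvm.restrict (by norm_num)).trans ?_) 2
    exact add_le_add (hsq (hub a)) (hsq (hvb a))

theorem AdmissiblePast.unifLocL2 {u : ℝ → ℝ} (hu : AdmissiblePast u) :
    UnifLocL2 ((Iio (0 : ℝ)).indicator u) := by
  obtain ⟨hm, C, hC⟩ := hu
  refine ⟨(aestronglyMeasurable_indicator_iff measurableSet_Iio).2 hm, (C : ℝ≥0∞) ^ 2,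
    ENNReal.pow_lt_top ENNReal.coe_lt_top, fun a => ?_⟩
  set b := min (a + 1) 0 with hb
  calc ∫⁻ t in Icc a (a + 1), ‖(Iio (0 : ℝ)).indicator u t‖ₑ ^ 2
      ≤ ∫⁻ t in Icc (b - 1) b, ‖u t‖ₑ ^ 2 := by
        rw [← lintegral_indicator measurableSet_Icc, ← lintegral_indicator measurableSet_Icc]
        refine lintegral_mono fun t => ?_
        by_cases h1 : t ∈ Icc a (a + 1)
        · by_cases h2 : t < 0
          · have h3 : t ∈ Icc (b - 1) b :=
              ⟨by linarith [min_le_left (a + 1) (0 : ℝ), h1.1], le_min h1.2 h2.le⟩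
            rw [indicator_of_mem h1, indicator_of_mem h3, indicator_of_mem (mem_Iio.2 h2)]
          · rw [indicator_of_mem h1, indicator_of_notMem (by simpa using h2)]
            simp
        · rw [indicator_of_notMem h1]; exact zero_le
    _ ≤ _ := by
        rw [lintegral_enorm_sq_eq]
        exact pow_le_pow_left' (hC b (min_le_right _ _)) 2

theorem lintegral_translate_le_nat_mul {u : ℝ → ℝ} {C : ℝ≥0∞}
    (h : ∀ a : ℝ, ∫⁻ t in Icc a (a + 1), ‖u t‖ₑ ^ 2 ≤ C) (s : ℝ) (n : ℕ) :
    ∫⁻ t in Icc 0 (n : ℝ), ‖u (t - s)‖ₑ ^ 2 ≤ n * C := by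
  induction n with
  | zero => simp
  | succ n ih =>
    have hsub : Icc (0 : ℝ) ((n + 1 : ℕ) : ℝ) ⊆ Icc 0 (n : ℝ) ∪ Icc (n : ℝ) (n + 1) := by
      push_cast
      intro t ht
      rcases le_total t n with h1 | h1
      · exact Or.inl ⟨ht.1, h1⟩
      · exact Or.inr ⟨h1, ht.2⟩
    calc _ ≤ _ := lintegral_mono_set hsub
      _ ≤ _ := lintegral_union_le _ _ _
      _ ≤ n * C + C := add_le_add ih (UnifLocL2.translate_le h _ _)
      _ = _ := by push_cast; ring

namespace StableLTI

variable (G : StableLTI)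

/-- The response to a past input that is uniformly locally square integrable has zero power. -/
theorem zeroPower_apply {u : ℝ → ℝ} (hu : UnifLocL2 u) (h0 : ∀ t, 0 ≤ t → u t = 0) :
    ZeroPower (G.apply u) := by
  have hu' := hu
  obtain ⟨-, C, hC, hb⟩ := hu'
  -- A delay `s` exposes the past only to times `t ≤ s`, so its energy on `[0, τ]` is that of about
  -- `min(s, τ)` unit intervals.
  let B : ℝ → ℕ ⊕ ℝ → ℝ≥0∞ := fun τ x => ((min ⌈G.lag x⌉₊ ⌈τ⌉₊ : ℕ) : ℝ≥0∞) * C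
  have hB : ∀ τ x, ∫⁻ t in Icc 0 τ, ‖u (t - G.lag x)‖ₑ ^ 2 ≤ B τ x := fun τ x => by
    refine le_trans ?_ (lintegral_translate_le_nat_mul hb (G.lag x) (min ⌈G.lag x⌉₊ ⌈τ⌉₊))
    rw [← lintegral_indicator measurableSet_Icc, ← lintegral_indicator measurableSet_Icc]
    refine lintegral_mono fun t => ?_
    by_cases h1 : t ∈ Icc 0 τ
    · rw [indicator_of_mem h1]
      by_cases h2 : t < G.lag x
      · rw [indicator_of_mem]
        refine ⟨h1.1, ?_⟩
        rw [Nat.cast_min]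
        exact le_min (h2.le.trans (Nat.le_ceil _)) (h1.2.trans (Nat.le_ceil _))
      · rw [h0 _ (by linarith)]; simp
    · rw [indicator_of_notMem h1]; exact zero_le
  have hle : ∀ τ : ℝ, (∫⁻ t in Icc 0 τ, ‖G.apply u t‖ₑ ^ 2) / ENNReal.ofReal τ ≤
      G.mass * ∫⁻ x, ‖G.weight x‖ₑ * (B τ x / ENNReal.ofReal τ) ∂measure := fun τ => by
    calc _ ≤ (G.mass * ∫⁻ x, ‖G.weight x‖ₑ * B τ x ∂measure) / ENNReal.ofReal τ := by
          refine ENNReal.div_le_div_right ((G.setLIntegral_sq_apply_le hu _).trans ?_) _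
          exact mul_le_mul_right (lintegral_mono fun x => mul_le_mul_right (hB τ x) _) _
      _ ≤ _ := by
          rw [mul_div_assoc]
          refine mul_le_mul_right ?_ _
          rw [ENNReal.div_eq_inv_mul]
          refine (lintegral_const_mul_le _ _).trans (lintegral_mono fun x => le_of_eq ?_)
          simp only [ENNReal.div_eq_inv_mul]
          ring
  obtain ⟨w, hw, hww⟩ := G.integrable_weight.1.enorm
  -- Dominated convergence: `B / τ` tends to zero for each fixed delay and is at most `2 C` for `τ ≥
  -- 1`, since `⌈τ⌉ ≤ 2τ`.
  have hlim : Tendsto (fun τ : ℝ => ∫⁻ x, w x * (B τ x / ENNReal.ofReal τ) ∂measure) atTop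
      (𝓝 (∫⁻ _, 0 ∂(measure : Measure (ℕ ⊕ ℝ)))) := by
    refine tendsto_lintegral_filter_of_dominated_convergence (fun x => w x * (2 * C))
      (Eventually.of_forall fun τ => ?_) ?_ ?_ ?_
    · have h1 : Measurable fun x => ((min ⌈G.lag x⌉₊ ⌈τ⌉₊ : ℕ) : ℝ≥0∞) :=
        (measurable_of_countable _).comp
          ((Nat.measurable_ceil.comp G.measurable_lag).min measurable_const)
      exact hw.mul ((h1.mul_const C).div_const _)
    · filter_upwards [eventually_ge_atTop 1] with τ hτ
      refine Eventually.of_forall fun x => mul_le_mul_right ?_ _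
      refine ENNReal.div_le_of_le_mul ?_
      have h1 : ((min ⌈G.lag x⌉₊ ⌈τ⌉₊ : ℕ) : ℝ≥0∞) ≤ 2 * ENNReal.ofReal τ := by
        rw [← ENNReal.ofReal_natCast, ← ENNReal.ofReal_ofNat 2, ← ENNReal.ofReal_mul (by norm_num)]
        refine ENNReal.ofReal_le_ofReal ?_
        have h2 : ((min ⌈G.lag x⌉₊ ⌈τ⌉₊ : ℕ) : ℝ) ≤ ⌈τ⌉₊ := by exact_mod_cast min_le_right _ _
        have h3 := Nat.ceil_lt_add_one (by linarith : 0 ≤ τ)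
        linarith
      calc B τ x ≤ 2 * ENNReal.ofReal τ * C := mul_le_mul_left h1 _
        _ = _ := by ring
    · have hfin : ∫⁻ x, w x ∂measure = G.mass := (lintegral_congr_ae hww).symm
      rw [lintegral_mul_const _ hw, hfin]
      exact (ENNReal.mul_lt_top G.mass_lt_top (ENNReal.mul_lt_top (by norm_num) hC)).ne
    · have hwt : ∀ᵐ x ∂(measure : Measure (ℕ ⊕ ℝ)), w x ≠ ∞ := by
        filter_upwards [hww] with x hx
        rw [← hx]; exact enorm_ne_top
      filter_upwards [hwt] with x hx
      have h1 : Tendsto (fun τ : ℝ => ((⌈G.lag x⌉₊ : ℝ≥0∞) * C) / ENNReal.ofReal τ) atTop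
          (𝓝 0) := by
        have := ENNReal.Tendsto.const_div (a := (⌈G.lag x⌉₊ : ℝ≥0∞) * C)
          (ENNReal.tendsto_ofReal_atTop)
          (Or.inr (ENNReal.mul_ne_top (ENNReal.natCast_ne_top _) hC.ne))
        simpa using this
      have h2 := ENNReal.Tendsto.const_mul (a := w x) h1 (Or.inr hx)
      rw [mul_zero] at h2
      refine tendsto_of_tendsto_of_tendsto_of_le_of_le tendsto_const_nhds h2 (fun _ => zero_le)
        fun τ => ?_
      refine mul_le_mul_right (ENNReal.div_le_div_right (mul_le_mul_left ?_ _) _) _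
      exact_mod_cast min_le_left _ _
  rw [lintegral_zero] at hlim
  have hlim2 := (ENNReal.Tendsto.const_mul (a := G.mass) hlim
    (Or.inr G.mass_lt_top.ne)).ennrpow_const (1 / 2)
  rw [mul_zero, ENNReal.zero_rpow_of_pos (by norm_num)] at hlim2
  refine tendsto_of_tendsto_of_tendsto_of_le_of_le tendsto_const_nhds hlim2 (fun _ => zero_le)
    fun τ => ?_
  rw [rms_eq]
  refine ENNReal.rpow_le_rpow ((hle τ).trans (le_of_eq ?_)) (by norm_num)
  congr 1
  exact lintegral_congr_ae (hww.mono fun x hx => by simp only [← hx])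

theorem memL2e_apply {u : ℝ → ℝ} (hu : UnifLocL2 u) : MemL2e (G.apply u) := by
  intro τ
  refine ⟨(G.aestronglyMeasurable_apply hu).restrict, ?_⟩
  have hu' := hu
  obtain ⟨-, C, hC, hb⟩ := hu'
  have h : ∫⁻ t in Icc 0 τ, ‖G.apply u t‖ₑ ^ 2 < ∞ := by
    refine (G.setLIntegral_sq_apply_le hu _).trans_lt (ENNReal.mul_lt_top G.mass_lt_top ?_)
    calc _ ≤ ∫⁻ x, ‖G.weight x‖ₑ * (⌈τ⌉₊ * C) ∂measure := by
          refine lintegral_mono fun x => mul_le_mul_right ?_ _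
          refine le_trans (lintegral_mono_set (Icc_subset_Icc_right (Nat.le_ceil τ))) ?_
          exact lintegral_translate_le_nat_mul hb _ _
      _ = G.mass * (⌈τ⌉₊ * C) := lintegral_mul_const' _ _
          (ENNReal.mul_ne_top (ENNReal.natCast_ne_top _) hC.ne)
      _ < ∞ := ENNReal.mul_lt_top G.mass_lt_top
          (ENNReal.mul_lt_top (ENNReal.natCast_lt_top _) hC)
  rw [lintegral_enorm_sq_eq] at h
  by_contra hcon
  rw [not_lt_top_iff] at hcon
  simp [hcon] at h

theorem eLpNorm_apply_le {u : ℝ → ℝ} (hu : MemLp u 2 volume) :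
    eLpNorm (G.apply u) 2 volume ≤ G.mass * eLpNorm u 2 volume := by
  have h := G.lintegral_sq_apply_le hu
  rw [lintegral_enorm_sq_eq, lintegral_enorm_sq_eq, ← mul_pow] at h
  exact (ENNReal.pow_le_pow_left_iff two_ne_zero).1 h

/-- The response on `[0, τ]` to the difference of two inputs splits into the response to the
difference on `[0, τ]` and the free response. -/
theorem apply_sub_apply {u v : ℝ → ℝ} (hu : AdmissiblePast u) (hv : AdmissiblePast v)
    (hu2 : MemL2e u) (hv2 : MemL2e v) (τ : ℝ) :
    ∀ᵐ t, t ∈ Icc 0 τ → G.apply u t - G.apply v t =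
      G.apply ((Icc 0 τ).indicator (u - v)) t + G.freeResponse (u - v) t := by
  have hcut : ∀ {w : ℝ → ℝ}, MemL2e w → UnifLocL2 ((Icc 0 τ).indicator w) := fun hw =>
    ((memLp_indicator_iff_restrict measurableSet_Icc).2 (hw τ)).unifLocL2
  have hcaus : ∀ w : ℝ → ℝ, ∀ t ≤ τ, G.apply w t =
      G.apply ((Icc 0 τ).indicator w + (Iio 0).indicator w) t := fun w t ht => by
    refine G.apply_congr fun s hs => ?_
    rw [Pi.add_apply]
    by_cases h : s < 0
    · simp [h, not_le.2 h]
    · simp [h, not_lt.1 h, hs.trans ht]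
  filter_upwards [G.apply_add_ae (hcut hu2) hu.unifLocL2, G.apply_add_ae (hcut hv2) hv.unifLocL2,
    G.apply_sub_ae (hcut hu2) (hcut hv2), G.apply_sub_ae hu.unifLocL2 hv.unifLocL2]
    with t h1 h2 h3 h4 ht
  rw [hcaus u t ht.2, hcaus v t ht.2, h1, h2, freeResponse, indicator_sub', indicator_sub', h3, h4]
  ring

theorem freeResponse_sub_unifLocL2 {u v : ℝ → ℝ} (hu : AdmissiblePast u) (hv : AdmissiblePast v) :
    UnifLocL2 ((Iio (0 : ℝ)).indicator (u - v)) := by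
  rw [indicator_sub']
  exact hu.unifLocL2.sub hv.unifLocL2

end StableLTI

/-! ## Deviations between two solutions of the loop -/

theorem ae_Ici_iff {P : ℝ → Prop} :
    (∀ᵐ t ∂(volume.restrict (Ici (0 : ℝ))), P t) ↔ ∀ᵐ t : ℝ, 0 ≤ t → P t :=
  ae_restrict_iff' measurableSet_Ici

theorem EqSignal.ae_Icc {x y : ℝ → ℝ} (h : EqSignal x y) (τ : ℝ) :
    x =ᵐ[volume.restrict (Icc 0 τ)] y :=
  ae_restrict_of_ae_restrict_of_subset Icc_subset_Ici_self h

theorem MemL2e.sub {x y : ℝ → ℝ} (hx : MemL2e x) (hy : MemL2e y) : MemL2e (x - y) :=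
  fun τ => (hx τ).sub (hy τ)

theorem MemL2e.memL2_of_eLpNorm_le {y : ℝ → ℝ} (hy : MemL2e y) {B : ℝ≥0∞} (hB : B < ∞)
    (h : ∀ τ : ℝ, 0 ≤ τ → eLpNorm y 2 (volume.restrict (Icc 0 τ)) ≤ B) : MemL2 y :=
  ⟨hy.aestronglyMeasurable, (eLpNorm_Ici_le h).trans_lt hB⟩

theorem eLpNorm_Icc_le_Ici (y : ℝ → ℝ) (τ : ℝ) :
    eLpNorm y 2 (volume.restrict (Icc 0 τ)) ≤ eLpNorm y 2 (volume.restrict (Ici 0)) :=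
  eLpNorm_mono_measure _ (Measure.restrict_mono Icc_subset_Ici_self le_rfl)

section Deviation

variable {G : StableLTI} {Q : ℝ → ℝ} {r₂ r₂' : ℝ → ℝ} {x p : LoopSignals}
  (hx : IsLuryeSolution G Q 0 r₂ x) (hp : IsLuryeSolution G Q 0 r₂' p)
include hx hp

theorem deviation_u₁ : EqSignal (x.u₁ - p.u₁) (-(x.y₂ - p.y₂)) := by
  unfold EqSignal
  filter_upwards [hx.eq_u₁, hp.eq_u₁] with t h1 h2
  simp only [Pi.sub_apply, Pi.neg_apply, Pi.zero_apply] at *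
  rw [h1, h2]; ring

theorem deviation_u₂ : EqSignal (x.u₂ - p.u₂) ((x.y₁ - p.y₁) + (r₂ - r₂')) := by
  unfold EqSignal
  filter_upwards [hx.eq_u₂, hp.eq_u₂] with t h1 h2
  simp only [Pi.sub_apply, Pi.add_apply]
  rw [h1, h2]; ring

/-- Read off from `u₂ = y₁ + r₂`, so local square integrability need not be assumed of either
exogenous signal. -/
theorem memL2e_deviation_r₂ : MemL2e (r₂ - r₂') := fun τ => by
  refine (((hx.u₂_mem.sub hp.u₂_mem) τ).sub ((hx.y₁_mem.sub hp.y₁_mem) τ)).ae_eq ?_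
  filter_upwards [(deviation_u₂ hx hp).ae_Icc τ] with t ht
  rw [Pi.sub_apply, ht, Pi.add_apply]; ring

theorem memL2e_freeResponse : MemL2e (G.freeResponse (x.u₁ - p.u₁)) :=
  G.memL2e_apply (StableLTI.freeResponse_sub_unifLocL2 hx.past hp.past)

theorem zeroPower_freeResponse : ZeroPower (G.freeResponse (x.u₁ - p.u₁)) :=
  G.zeroPower_apply (StableLTI.freeResponse_sub_unifLocL2 hx.past hp.past) fun t ht =>
    indicator_of_notMem (by simpa using ht) _

theorem memLp_truncated_deviation (τ : ℝ) :
    MemLp ((Icc 0 τ).indicator (x.y₂ - p.y₂)) 2 volume :=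
  (memLp_indicator_iff_restrict measurableSet_Icc).2 ((hx.y₂_mem.sub hp.y₂_mem) τ)

theorem deviation_y₁ (τ : ℝ) : ∀ᵐ t, t ∈ Icc 0 τ → (x.y₁ - p.y₁) t =
    G.freeResponse (x.u₁ - p.u₁) t - G.apply ((Icc 0 τ).indicator (x.y₂ - p.y₂)) t := by
  have h1 := G.apply_sub_apply hx.past hp.past hx.u₁_mem hp.u₁_mem τ
  have hL := memLp_truncated_deviation hx hp τ
  have h2 : (Icc 0 τ).indicator (x.u₁ - p.u₁) =ᵐ[volume]
      -(Icc 0 τ).indicator (x.y₂ - p.y₂) := by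
    filter_upwards [ae_Ici_iff.1 (deviation_u₁ hx hp)] with t ht
    by_cases h : t ∈ Icc 0 τ
    · rw [Pi.neg_apply, indicator_of_mem h, indicator_of_mem h, ht h.1, Pi.neg_apply]
    · rw [Pi.neg_apply, indicator_of_notMem h, indicator_of_notMem h, neg_zero]
  have h3 := G.apply_congr_ae
    ((memLp_indicator_iff_restrict measurableSet_Icc).2
      ((hx.u₁_mem.sub hp.u₁_mem) τ)).unifLocL2 hL.neg.unifLocL2 h2
  filter_upwards [h1, h3, ae_Ici_iff.1 hx.eq_y₁, ae_Ici_iff.1 hp.eq_y₁] with t h4 h5 h6 h7 ht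
  rw [Pi.sub_apply, h6 ht.1, h7 ht.1, h4 ht, h5, G.apply_neg]
  ring

theorem eLpNorm_deviation_y₁_le (τ : ℝ) :
    eLpNorm (x.y₁ - p.y₁) 2 (volume.restrict (Icc 0 τ)) ≤
      1 * eLpNorm (G.freeResponse (x.u₁ - p.u₁)) 2 (volume.restrict (Icc 0 τ)) +
        G.mass * eLpNorm (x.y₂ - p.y₂) 2 (volume.restrict (Icc 0 τ)) := by
  have hL := memLp_truncated_deviation hx hp τ
  have h1 : x.y₁ - p.y₁ =ᵐ[volume.restrict (Icc 0 τ)]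
      G.freeResponse (x.u₁ - p.u₁) - G.apply ((Icc 0 τ).indicator (x.y₂ - p.y₂)) :=
    (ae_restrict_iff' measurableSet_Icc).2 (deviation_y₁ hx hp τ)
  rw [eLpNorm_congr_ae h1, one_mul]
  refine (eLpNorm_sub_le (memL2e_freeResponse hx hp τ).1 (G.memLp_apply hL).1.restrict
    (by norm_num)).trans ?_
  gcongr
  refine (eLpNorm_mono_measure _ Measure.restrict_le_self).trans ((G.eLpNorm_apply_le hL).trans ?_)
  rw [eLpNorm_indicator_eq_eLpNorm_restrict measurableSet_Icc]

theorem eLpNorm_deviation_u₁ (τ : ℝ) : eLpNorm (x.u₁ - p.u₁) 2 (volume.restrict (Icc 0 τ)) =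
    eLpNorm (x.y₂ - p.y₂) 2 (volume.restrict (Icc 0 τ)) := by
  rw [eLpNorm_congr_ae ((deviation_u₁ hx hp).ae_Icc τ), eLpNorm_neg]

theorem eLpNorm_deviation_u₂_le (τ : ℝ) :
    eLpNorm (x.u₂ - p.u₂) 2 (volume.restrict (Icc 0 τ)) ≤
      1 * eLpNorm (x.y₁ - p.y₁) 2 (volume.restrict (Icc 0 τ)) +
        1 * eLpNorm (r₂ - r₂') 2 (volume.restrict (Icc 0 τ)) := by
  rw [eLpNorm_congr_ae ((deviation_u₂ hx hp).ae_Icc τ), one_mul, one_mul]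
  exact eLpNorm_add_le ((hx.y₁_mem.sub hp.y₁_mem) τ).1 (memL2e_deviation_r₂ hx hp τ).1 (by norm_num)

/-- The truncated gain bound on the deviation from a periodic solution. -/
theorem eLpNorm_deviation_y₂_le {T : ℝ} (hT : 0 < T) (hper : PeriodicSignal T p.u₂)
    (M : AltshullerMultiplier T) (hQ : Monotone Q) {C : ℝ} (hC : ∀ x, |Q x| ≤ C * |x|) {κ : ℝ}
    (hκ : 0 ≤ κ) (hslope : ∀ x y, x ≤ y → κ * (Q y - Q x) ≤ y - x) {h : ℝ} (h_pos : 0 < h)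
    (hh : ∀ ω, 1 + ‖M.freq ω‖ ^ 2 ≤ 2 * h * (M.freq ω * (κ + G.freq ω)).re) {τ : ℝ} (hτ : 0 ≤ τ) :
    eLpNorm (x.y₂ - p.y₂) 2 (volume.restrict (Icc 0 τ)) ≤
      ENNReal.ofReal h * eLpNorm ((r₂ - r₂') + G.freeResponse (x.u₁ - p.u₁)) 2
        (volume.restrict (Icc 0 τ)) := by
  -- The multiplier shifts in both directions, so the reference signal must be exactly periodic on
  -- the whole line.
  obtain ⟨u, huper, hu, hum, hup⟩ := hper.exists_periodic hT hp.u₂_mem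
  refine eLpNorm_output_le G M hQ hC hκ hslope h_pos hh huper hu hum hτ
    (e := x.u₂ - p.u₂) ((hx.y₂_mem.sub hp.y₂_mem) τ) ((hx.u₂_mem.sub hp.u₂_mem) τ)
    ((memL2e_deviation_r₂ hx hp τ).add (memL2e_freeResponse hx hp τ)) ?_ ?_
  · filter_upwards [ae_Ici_iff.1 hx.eq_y₂, ae_Ici_iff.1 hp.eq_y₂, ae_Ici_iff.1 hup]
      with t h1 h2 h3 ht
    rw [Pi.sub_apply, Pi.sub_apply, h1 ht.1, h2 ht.1, h3 ht.1, add_sub_cancel]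
  · filter_upwards [ae_Ici_iff.1 (deviation_u₂ hx hp), deviation_y₁ hx hp τ] with t h1 h2 ht
    rw [h1 ht.1, Pi.add_apply, h2 ht, Pi.add_apply]
    ring

end Deviation

/-! ## Consequences of the truncated gain bound -/

theorem eqSignal_of_zeroPower {T : ℝ} (hT : 0 < T) {a b : ℝ → ℝ} (ha : PeriodicSignal T a)
    (hb' : PeriodicSignal T b) (ham : MemL2e a) (hbm : MemL2e b) (hz : ZeroPower (a - b)) :
    EqSignal a b := by
  have := (ha.sub hb').eqSignal_zero hT (ham.sub hbm) hz
  unfold EqSignal at *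
  filter_upwards [this] with t ht
  exact sub_eq_zero.1 ht

section Consequences

variable {G : StableLTI} {Q : ℝ → ℝ} {T : ℝ} {r₂s : ℝ → ℝ} {p : LoopSignals} {H : ℝ≥0∞}
  (hp : IsPeriodicSolution G Q T r₂s p) (hH : H ≠ ∞)
  (hb : ∀ r₂ x, IsLuryeSolution G Q 0 r₂ x → ∀ τ : ℝ, 0 ≤ τ →
    eLpNorm (x.y₂ - p.y₂) 2 (volume.restrict (Icc 0 τ)) ≤
      H * eLpNorm ((r₂ - r₂s) + G.freeResponse (x.u₁ - p.u₁)) 2 (volume.restrict (Icc 0 τ)))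
include hp hb

theorem eLpNorm_deviation_le_add {r₂ : ℝ → ℝ} {x : LoopSignals}
    (hx : IsLuryeSolution G Q 0 r₂ x) {τ : ℝ} (hτ : 0 ≤ τ) :
    eLpNorm (x.y₂ - p.y₂) 2 (volume.restrict (Icc 0 τ)) ≤
      H * eLpNorm (r₂ - r₂s) 2 (volume.restrict (Icc 0 τ)) +
        H * eLpNorm (G.freeResponse (x.u₁ - p.u₁)) 2 (volume.restrict (Icc 0 τ)) := by
  refine (hb r₂ x hx τ hτ).trans ?_
  rw [← mul_add]
  gcongr
  exact eLpNorm_add_le (memL2e_deviation_r₂ hx hp.sol τ).1 (memL2e_freeResponse hx hp.sol τ).1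
    (by norm_num)

include hH

/-- With `r₂` unchanged the deviation loop is driven only by the free response, which has zero
power. The gain bound passes this to `y₂`, and the loop equations to the other signals. -/
theorem zeroPower_deviations {x : LoopSignals} (hx : IsLuryeSolution G Q 0 r₂s x) :
    ZeroPower (x.u₁ - p.u₁) ∧ ZeroPower (x.u₂ - p.u₂) ∧ ZeroPower (x.y₁ - p.y₁) ∧
      ZeroPower (x.y₂ - p.y₂) := by
  have hr : ZeroPower (r₂s - r₂s) := by rw [sub_self]; exact zeroPower_zero
  have hf := zeroPower_freeResponse hx hp.sol
  have hy₂ : ZeroPower (x.y₂ - p.y₂) :=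
    ZeroPower.of_le hH hH (fun τ hτ => eLpNorm_deviation_le_add hp hb hx hτ) hr hf
  have hy₁ : ZeroPower (x.y₁ - p.y₁) :=
    ZeroPower.of_le ENNReal.one_ne_top G.mass_lt_top.ne
      (fun τ _ => eLpNorm_deviation_y₁_le hx hp.sol τ) hf hy₂
  have hu₂ : ZeroPower (x.u₂ - p.u₂) :=
    ZeroPower.of_le ENNReal.one_ne_top ENNReal.one_ne_top
      (fun τ _ => eLpNorm_deviation_u₂_le hx hp.sol τ) hy₁ hr
  have hu₁ : ZeroPower (x.u₁ - p.u₁) := by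
    refine hy₂.congr fun τ => ?_
    rw [rms, rms, eLpNorm_deviation_u₁ hx hp.sol]
  exact ⟨hu₁, hu₂, hy₁, hy₂⟩

theorem isUniquePeriodicSolution_of_bound (hT : 0 < T) :
    IsUniquePeriodicSolution G Q T r₂s p := by
  refine ⟨fun x hx => ?_, fun x hx hper => ?_⟩
  · obtain ⟨h1, h2, h3, h4⟩ := zeroPower_deviations hp hH hb hx.sol
    exact ⟨eqSignal_of_zeroPower hT hx.u₁_per hp.u₁_per hx.sol.u₁_mem hp.sol.u₁_mem h1,
      eqSignal_of_zeroPower hT hx.u₂_per hp.u₂_per hx.sol.u₂_mem hp.sol.u₂_mem h2,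
      eqSignal_of_zeroPower hT hx.y₁_per hp.y₁_per hx.sol.y₁_mem hp.sol.y₁_mem h3,
      eqSignal_of_zeroPower hT hx.y₂_per hp.y₂_per hx.sol.y₂_mem hp.sol.y₂_mem h4⟩
  · obtain ⟨-, -, -, h4⟩ := zeroPower_deviations hp hH hb hx
    exact eqSignal_of_zeroPower hT hper hp.y₂_per hx.y₂_mem hp.sol.y₂_mem h4

theorem isGlobalAttractor_of_bound : IsGlobalAttractor G Q r₂s p := by
  refine ⟨fun r₂ x hr hx hf => ?_, fun x hx => ?_⟩
  · have hy₂ : MemL2 (x.y₂ - p.y₂) := by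
      refine (hx.y₂_mem.sub hp.sol.y₂_mem).memL2_of_eLpNorm_le
        (B := H * normL2 (r₂ - r₂s) + H * normL2 (G.freeResponse (x.u₁ - p.u₁))) ?_ fun τ hτ => ?_
      · exact ENNReal.add_lt_top.2 ⟨ENNReal.mul_lt_top hH.lt_top hr.2,
          ENNReal.mul_lt_top hH.lt_top hf.2⟩
      · refine (eLpNorm_deviation_le_add hp hb hx hτ).trans ?_
        gcongr <;> exact eLpNorm_Icc_le_Ici _ τ
    have hy₁ : MemL2 (x.y₁ - p.y₁) := by
      refine (hx.y₁_mem.sub hp.sol.y₁_mem).memL2_of_eLpNorm_le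
        (B := 1 * normL2 (G.freeResponse (x.u₁ - p.u₁)) + G.mass * normL2 (x.y₂ - p.y₂)) ?_
        fun τ _ => ?_
      · exact ENNReal.add_lt_top.2 ⟨ENNReal.mul_lt_top ENNReal.one_lt_top hf.2,
          ENNReal.mul_lt_top G.mass_lt_top hy₂.2⟩
      · refine (eLpNorm_deviation_y₁_le hx hp.sol τ).trans ?_
        gcongr <;> exact eLpNorm_Icc_le_Ici _ τ
    have hu₂ : MemL2 (x.u₂ - p.u₂) :=
      (MemLp.add hy₁ hr).ae_eq (EventuallyEq.symm (deviation_u₂ hx hp.sol))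
    have hu₁ : MemL2 (x.u₁ - p.u₁) :=
      (MemLp.neg hy₂).ae_eq (EventuallyEq.symm (deviation_u₁ hx hp.sol))
    exact ⟨⟨hu₁, hu₁.energyVanishes⟩, ⟨hu₂, hu₂.energyVanishes⟩, ⟨hy₁, hy₁.energyVanishes⟩,
      ⟨hy₂, hy₂.energyVanishes⟩⟩
  · obtain ⟨h1, h2, h3, h4⟩ := zeroPower_deviations hp hH hb hx
    exact ⟨h1.powerSeminorm_eq, h2.powerSeminorm_eq, h3.powerSeminorm_eq, h4.powerSeminorm_eq⟩

/-- Equal pasts make the free response vanish, leaving only the deviation of `r₂`. For power, the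
free response does not affect the upper limit, whatever the pasts. -/
theorem deviationBounds_of_bound : DeviationBounds G Q r₂s p H := by
  refine ⟨fun r₂ x hx hpast hr => ?_, fun r₂ x hx _ => ?_⟩
  · have hfree : G.freeResponse (x.u₁ - p.u₁) =ᵐ[volume] 0 := by
      have h0 : (Iio (0 : ℝ)).indicator (x.u₁ - p.u₁) =ᵐ[volume] 0 := by
        filter_upwards [(ae_restrict_iff' measurableSet_Iio).1 hpast] with t ht
        by_cases h : t ∈ Iio (0 : ℝ)
        · rw [indicator_of_mem h, Pi.sub_apply, ht h, sub_self]; rfl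
        · rw [indicator_of_notMem h]; rfl
      refine (G.apply_congr_ae (StableLTI.freeResponse_sub_unifLocL2 hx.past hp.sol.past)
        (MemLp.zero (p := 2)).unifLocL2 h0).trans (Eventually.of_forall fun t => ?_)
      exact G.apply_zero t
    refine eLpNorm_Ici_le fun τ hτ => (hb r₂ x hx τ hτ).trans ?_
    gcongr
    refine le_trans (le_of_eq (eLpNorm_congr_ae (ae_restrict_of_ae ?_)))
      (eLpNorm_Icc_le_Ici (r₂ - r₂s) τ)
    filter_upwards [hfree] with t ht
    rw [Pi.add_apply, ht, Pi.zero_apply, add_zero]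
  · exact powerSeminorm_le_of_le hH (fun τ hτ => eLpNorm_deviation_le_add hp hb hx hτ)
      (zeroPower_freeResponse hx hp.sol)

end Consequences

/-! ## The gain bound of a suitable multiplier -/

section GainBound

variable {T : ℝ} (M : AltshullerMultiplier T) {F : ℝ → ℂ}

theorem gainBound_lt_top (hs : Suitable M.freq F) : gainBound M.freq F < ∞ := by
  obtain ⟨ε, hε, h⟩ := hs
  -- The numerator is at most `5` because `|M| ≤ 2`, and the denominator exceeds `2ε`.
  refine lt_of_le_of_lt (iSup_le fun ω => ENNReal.ofReal_le_ofReal ?_)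
    (ENNReal.ofReal_lt_top (r := 5 / (2 * ε)))
  have hM := M.norm_freq_le ω
  have hn := norm_nonneg (M.freq ω)
  refine div_le_div₀ (by norm_num) (by nlinarith) (by positivity) ?_
  linarith [h ω]

theorem gainBound_spec (hs : Suitable M.freq F) : 0 < (gainBound M.freq F).toReal ∧
    ∀ ω, 1 + ‖M.freq ω‖ ^ 2 ≤ 2 * (gainBound M.freq F).toReal * (M.freq ω * F ω).re := by
  have htop := gainBound_lt_top M hs
  obtain ⟨ε, hε, h⟩ := hs
  have hle : ∀ ω, (1 + ‖M.freq ω‖ ^ 2) / (2 * (M.freq ω * F ω).re) ≤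
      (gainBound M.freq F).toReal := fun ω =>
    (ENNReal.ofReal_le_iff_le_toReal htop.ne).1
      (le_iSup (fun ω => ENNReal.ofReal ((1 + ‖M.freq ω‖ ^ 2) / (2 * (M.freq ω * F ω).re))) ω)
  have hpos : ∀ ω, 0 < 2 * (M.freq ω * F ω).re := fun ω => by linarith [h ω]
  refine ⟨lt_of_lt_of_le (div_pos (by positivity) (hpos 0)) (hle 0), fun ω => ?_⟩
  have := (div_le_iff₀ (hpos ω)).1 (hle ω)
  linarith

end GainBound

/-- The parameter `κ` treats both hypotheses at once: `κ = 0` for a merely monotone `Q`, `κ = 1/k`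
for a slope restriction. -/
theorem lurye_periodic_stability {G : StableLTI} {Q : ℝ → ℝ} (hQ : IsMMB Q) {T : ℝ} (hT : 0 < T)
    {r₂s : ℝ → ℝ} {p : LoopSignals} (hp : IsPeriodicSolution G Q T r₂s p)
    (M : AltshullerMultiplier T) {κ : ℝ} (hκ : 0 ≤ κ)
    (hslope : ∀ x y, x ≤ y → κ * (Q y - Q x) ≤ y - x) {F : ℝ → ℂ}
    (hF : ∀ ω, F ω = κ + G.freq ω) (hs : Suitable M.freq F) :
    IsUniquePeriodicSolution G Q T r₂s p ∧ IsGlobalAttractor G Q r₂s p ∧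
      gainBound M.freq F < ∞ ∧ DeviationBounds G Q r₂s p (gainBound M.freq F) := by
  obtain ⟨hmono, C, -, hC⟩ := hQ
  have htop := gainBound_lt_top M hs
  obtain ⟨h_pos, hh⟩ := gainBound_spec M hs
  simp only [hF] at hh
  have hb : ∀ r₂ x, IsLuryeSolution G Q 0 r₂ x → ∀ τ : ℝ, 0 ≤ τ →
      eLpNorm (x.y₂ - p.y₂) 2 (volume.restrict (Icc 0 τ)) ≤
        gainBound M.freq F * eLpNorm ((r₂ - r₂s) + G.freeResponse (x.u₁ - p.u₁)) 2
          (volume.restrict (Icc 0 τ)) := fun r₂ x hx τ hτ => by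
    have := eLpNorm_deviation_y₂_le hx hp.sol hT hp.u₂_per M hmono hC hκ hslope h_pos hh hτ
    rwa [ENNReal.ofReal_toReal htop.ne] at this
  exact ⟨isUniquePeriodicSolution_of_bound hp htop.ne hb hT,
    isGlobalAttractor_of_bound hp htop.ne hb, htop, deviationBounds_of_bound hp htop.ne hb⟩

theorem SlopeRestricted.inv_mul_sub_le {k : ℝ} (hk : 0 < k) {Q : ℝ → ℝ} (hQ : SlopeRestricted k Q)
    {x y : ℝ} (hxy : x ≤ y) : 1 / k * (Q y - Q x) ≤ y - x := by
  rcases hxy.eq_or_lt with rfl | hlt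
  · simp
  · have h := (hQ y x hlt.ne').2
    rw [div_le_iff₀ (sub_pos.2 hlt)] at h
    rw [one_div, inv_mul_le_iff₀ hk]
    exact h

end

theorem theorem7 (G : StableLTI) (Q : ℝ → ℝ) (hQ : IsMMB Q) (hwp : WellPosed G Q)
    (T : ℝ) (hT : 0 < T)
    (r₂s : ℝ → ℝ) (hr : MemL2e r₂s) (hr_per : PeriodicSignal T r₂s) (hr_ne : ¬ EqSignal r₂s 0)
    (p : LoopSignals) (hp : IsPeriodicSolution G Q T r₂s p) (hp_ne : ¬ EqSignal p.y₂ 0) :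
    (∀ M : AltshullerMultiplier T, Suitable M.freq G.freq →
      IsUniquePeriodicSolution G Q T r₂s p ∧ IsGlobalAttractor G Q r₂s p ∧
      gainBound M.freq G.freq < ∞ ∧
      DeviationBounds G Q r₂s p (gainBound M.freq G.freq)) ∧
    (∀ k : ℝ, 0 < k → SlopeRestricted k Q → ∀ M : AltshullerMultiplier T,
      Suitable M.freq (fun ω => 1 / (k : ℂ) + G.freq ω) →
      IsUniquePeriodicSolution G Q T r₂s p ∧ IsGlobalAttractor G Q r₂s p ∧
      gainBound M.freq (fun ω => 1 / (k : ℂ) + G.freq ω) < ∞ ∧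
      DeviationBounds G Q r₂s p (gainBound M.freq (fun ω => 1 / (k : ℂ) + G.freq ω))) := by
  refine ⟨fun M hs => ?_, fun k hk hslope M hs => ?_⟩
  · exact lurye_periodic_stability hQ hT hp M le_rfl
      (fun x y hxy => by rw [zero_mul]; exact sub_nonneg.2 hxy) (fun ω => by simp) hs
  · exact lurye_periodic_stability hQ hT hp M (κ := 1 / k) (by positivity)
      (fun x y hxy => hslope.inv_mul_sub_le hk hxy) (fun ω => by push_cast; rfl) hs
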